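/- Conventions. $\mathbf e$ is a column vector of ones and $\otimes$ the Kronecker product. A probability vector is a nonnegative row vector with sum $1$. A subtransition matrix is a square matrix $T\ge 0$ with row sums at most $1$ and $I-T$ invertible; a subgenerator matrix is a square real matrix $T$ with nonnegative off-diagonal entries and row sums at most $0$ that is invertible. For a probability vector $\alpha$, write $M\sim PH_d(\alpha,T)$ ($T$ a subtransition matrix) if $M$ is distributed as the time to absorption of the discrete-time Markov chain with initial distribution $(\alpha,0)$ and transition matrix $\begin{bmatrix}T&\mathbf e-T\mathbf e\\ 0&1\end{bmatrix}$, and $Z\sim PH_c(\alpha,T)$ ($T$ a subgenerator matrix) if $Z$ is distributed as the time to absorption of the continuous-time Markov chain with initial distribution $(\alpha,0)$ and generator $\begin{bmatrix}T&-T\mathbf e\\ 0&0\end{bmatrix}$. Proposition. Let $Y_1,Y_2,\dots$ be i.i.d. with $Y_m\sim PH_c(\alpha_c,T_c)$. (a) Let $M\sim PH_d(\alpha_d,T_d)$ be independent of $(Y_m)_{m\ge1}$ and let $Z=\sum_{m=1}^M Y_m$. Put $$\alpha_Z=\alpha_d\otimes\alpha_c,\qquad T_Z=I\otimes T_c+T_d\otimes(-T_c\,\mathbf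 e\,\alpha_c).$$ Then $Z\sim PH_c(\alpha_Z,T_Z)$. Moreover, the law of $Z$ has the density $f(z)=-\alpha_Z\exp(zT_Z)T_Z\mathbf e$, $z\ge0$, and for every integer $p\ge1$ the moment $\mathbb E[Z^p]$ is finite and equals $p!\,\alpha_Z(-T_Z^{-1})^p\mathbf e$. (b) In particular this holds for circular $k$-out-of-$n$: G balanced systems in a shock environment. Such a system has $n$ units and a balance condition, which may be any condition on sets of units; a state, described by its set of nonfailed units, is nonfailed if it contains a minimal (with respect to inclusion) element among the balanced sets of at least $k$ units, and failed otherwise. Let $k\ge1$, let the state $x_1$ with no failed unit be nonfailed, and let $0\le r<1$. Let the states $X_0,X_1,X_2,\dots$ after $0,1,2,\dots$ shocks form a Markov chain with $X_0=x_1$ such that at every shock each nonfailed unit, independently of the others, survives with probability $r$ and fails with probability $1-r$, and failed units stay failed. Let $P_{\mathrm{BC}}$ be the matrix of one-shock transition probabilities between nonfailed states, let $\alpha_d$ be the unit mass at $x_1$, and let $M=\inf\{\nu\ge1: X_\nu\text{ is failed}\}$ be the shock number to failure. Then $M\sim PH_d(\alpha_d,P_{\mathrm{BC}})$; hence, if $M$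 is independent of $(Y_m)_{m\ge1}$ (the inter-shock times), all conclusions of (a) hold for the time to failure $Z=\sum_{m=1}^M Y_m$ with this $\alpha_d$ and $T_d=P_{\mathrm{BC}}$. -/

import Mathlib

open MeasureTheory ProbabilityTheory
open scoped Kronecker Matrix

noncomputable section

namespace PhaseType

variable {ι κ : Type*} [Fintype ι] [DecidableEq ι] [Fintype κ] [DecidableEq κ]

/-- A probability vector (no mass is put on the absorbing state). -/
structure IsProbVec (α : ι → ℝ) : Prop where
  nonneg : ∀ i, 0 ≤ α i
  sum_eq_one : ∑ i, α i = 1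

/-- A subtransition matrix: the one-step transition matrix between the transient states of an
absorbing discrete-time Markov chain. It is nonnegative, its row sums are at most one, and
absorption is certain from every state, which for such a matrix means that `1 - T` is
invertible. -/
structure IsSubtransition (T : Matrix ι ι ℝ) : Prop where
  nonneg : ∀ i j, 0 ≤ T i j
  row_sum_le : ∀ i, ∑ j, T i j ≤ 1
  isUnit : IsUnit (1 - T)

/-- A subgenerator matrix: the transition rates between the transient states of an absorbing
continuous-time Markov chain. Off-diagonal entries are nonnegative, the row sums are at most
zero, and absorption is certain from every state, which for such a matrix means that `T` is
invertible. -/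
structure IsSubgenerator (T : Matrix ι ι ℝ) : Prop where
  offDiag_nonneg : ∀ i j, i ≠ j → 0 ≤ T i j
  row_sum_le : ∀ i, ∑ j, T i j ≤ 0
  isUnit : IsUnit T

/-- The initial distribution of the absorbing chain on `ι ⊕ Unit`; the state `Sum.inr ()` is the
absorbing one. -/
def absorbingInit (α : ι → ℝ) : ι ⊕ Unit → ℝ := Sum.elim α 0

/-- The transition matrix `[[T, e - T e], [0, 1]]` of the absorbing discrete-time chain. -/
def absorbingTransition (T : Matrix ι ι ℝ) : Matrix (ι ⊕ Unit) (ι ⊕ Unit) ℝ :=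
  Matrix.fromBlocks T (Matrix.replicateCol Unit (1 - T *ᵥ 1)) 0 1

/-- The generator `[[T, - T e], [0, 0]]` of the absorbing continuous-time chain. -/
def absorbingGenerator (T : Matrix ι ι ℝ) : Matrix (ι ⊕ Unit) (ι ⊕ Unit) ℝ :=
  Matrix.fromBlocks T (Matrix.replicateCol Unit (-(T *ᵥ 1))) 0 0

variable {Ω : Type*} [MeasurableSpace Ω]

/-- `M ~ PH_d(α, T)`: the random variable `M` has the law of the time to absorption of the
discrete-time Markov chain with initial distribution `α` and transition matrix
`[[T, e - T e], [0, 1]]`. As the state `Sum.inr ()` is absorbing, the chain has been absorbed by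
time `m` exactly if it is in that state at time `m`. -/
structure IsPHd (M : Ω → ℕ) (μ : Measure Ω) (α : ι → ℝ) (T : Matrix ι ι ℝ) : Prop where
  probVec : IsProbVec α
  subtransition : IsSubtransition T
  aemeasurable : AEMeasurable M μ
  measure_le : ∀ m : ℕ, μ {ω | M ω ≤ m} =
    ENNReal.ofReal ((absorbingInit α ᵥ* absorbingTransition T ^ m) (Sum.inr ()))

/-- `Z ~ PH_c(α, T)`: the random variable `Z` has the law of the time to absorption of the
continuous-time Markov chain with initial distribution `α` and generator `Q = [[T, - T e], [0, 0]]`,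
whose transition matrix over a period of length `t` is `exp (t Q)`. As the state `Sum.inr ()` is
absorbing, the chain has been absorbed by time `t` exactly if it is in that state at time `t`. -/
structure IsPHc (Z : Ω → ℝ) (μ : Measure Ω) (α : ι → ℝ) (T : Matrix ι ι ℝ) : Prop where
  probVec : IsProbVec α
  subgenerator : IsSubgenerator T
  aemeasurable : AEMeasurable Z μ
  measure_le : ∀ t : ℝ, 0 ≤ t → μ {ω | Z ω ≤ t} =
    ENNReal.ofReal
      ((absorbingInit α ᵥ* NormedSpace.exp (t • absorbingGenerator T)) (Sum.inr ()))

/-- The function `z ↦ - α exp(z T) T e`. -/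
def phDensity (α : ι → ℝ) (T : Matrix ι ι ℝ) (z : ℝ) : ℝ :=
  -(α ⬝ᵥ ((NormedSpace.exp (z • T) * T) *ᵥ 1))

/-- The law of `Z` is carried by `[0, ∞)` and has there the density `- α exp(z T) T e` (a
nonnegative function) with respect to Lebesgue measure. -/
def HasPHDensity (Z : Ω → ℝ) (μ : Measure Ω) (α : ι → ℝ) (T : Matrix ι ι ℝ) : Prop :=
  (∀ z, 0 ≤ z → 0 ≤ phDensity α T z) ∧
    μ.map Z = (volume.restrict (Set.Ici 0)).withDensity fun z => ENNReal.ofReal (phDensity α T z)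

/-- For every `p ≥ 1` the `p`-th moment of `Z` exists and equals `p! α (-T⁻¹)^p e`. -/
def HasPHMoments (Z : Ω → ℝ) (μ : Measure Ω) (α : ι → ℝ) (T : Matrix ι ι ℝ) : Prop :=
  ∀ p : ℕ, 1 ≤ p → Integrable (fun ω => Z ω ^ p) μ ∧
    ∫ ω, Z ω ^ p ∂μ = (p.factorial : ℝ) * (α ⬝ᵥ (((-T⁻¹) ^ p) *ᵥ 1))

/-- The Kronecker product `α_d ⊗ α_c` of two row vectors. -/
def compoundInit (αd : ι → ℝ) (αc : κ → ℝ) : ι × κ → ℝ := fun x => αd x.1 * αc x.2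

/-- The matrix `I ⊗ T_c + T_d ⊗ (-T_c e α_c)`. -/
def compoundSubgenerator (Td : Matrix ι ι ℝ) (αc : κ → ℝ) (Tc : Matrix κ κ ℝ) :
    Matrix (ι × κ) (ι × κ) ℝ :=
  (1 : Matrix ι ι ℝ) ⊗ₖ Tc + Td ⊗ₖ Matrix.vecMulVec (-(Tc *ᵥ 1)) αc

/-- The compound sum `∑_{m=1}^{M} Y_m`; here `Y m` stands for `Y_{m+1}`. -/
def randomSum (M : Ω → ℕ) (Y : ℕ → Ω → ℝ) (ω : Ω) : ℝ := ∑ m ∈ Finset.range (M ω), Y m ω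

end PhaseType

namespace BalancedSystem

/-! A circular `k`-out-of-`n`: G balanced system. The units are labelled by `Fin n` around the
circle, and a system state is recorded as the set of its nonfailed units. The balance condition
`BC` is an arbitrary predicate on the set of units that are switched on. -/

variable {n : ℕ}

/-- The minimum tie-sets: the minimal sets of at least `k` units that are balanced. -/
def IsMinTieSet (k : ℕ) (BC : Finset (Fin n) → Prop) (A : Finset (Fin n)) : Prop :=
  Minimal (fun B => k ≤ B.card ∧ BC B) A

/-- A state is nonfailed if its nonfailed units include a minimum tie-set (the other units can be
switched off). -/
def Nonfailed (k : ℕ) (BC : Finset (Fin n) → Prop) (x : Finset (Fin n)) : Prop :=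
  ∃ A, IsMinTieSet k BC A ∧ A ⊆ x

/-- The nonfailed states of the system. -/
abbrev NonfailedState (k : ℕ) (BC : Finset (Fin n) → Prop) : Type :=
  {x : Finset (Fin n) // Nonfailed k BC x}

instance (k : ℕ) (BC : Finset (Fin n) → Prop) : Fintype (NonfailedState k BC) :=
  Fintype.ofFinite _

/-- The one-shock transition probability from state `a` to state `b`: independently, each nonfailed
unit survives with probability `r` and fails with probability `1 - r`; a failed unit stays
failed. -/
def shockTransition (r : ℝ) (a b : Finset (Fin n)) : ℝ :=
  ∏ i, if i ∈ a then (if i ∈ b then r else 1 - r) else (if i ∈ b then 0 else 1)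

/-- The matrix `P_BC` of one-shock transition probabilities between nonfailed states. -/
def PBC (k : ℕ) (BC : Finset (Fin n) → Prop) (r : ℝ) :
    Matrix (NonfailedState k BC) (NonfailedState k BC) ℝ :=
  Matrix.of fun a b => shockTransition r a.1 b.1

/-- The initial vector `[1, 0, …, 0]`, whose unit mass sits at the perfect state. -/
def perfectInit (k : ℕ) (BC : Finset (Fin n) → Prop) : NonfailedState k BC → ℝ :=
  fun a => if a.1 = Finset.univ then 1 else 0

variable {Ω : Type*} [MeasurableSpace Ω]

/-- `X ν` is the system state after `ν` shocks: a Markov chain on the full state space that starts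
in the perfect state and has the one-shock transition probabilities. -/
structure IsStateProcess (r : ℝ) (X : ℕ → Ω → Finset (Fin n)) (μ : Measure Ω) : Prop where
  measurableSet : ∀ ν x, MeasurableSet {ω | X ν ω = x}
  measure_path : ∀ (m : ℕ) (x : ℕ → Finset (Fin n)),
    μ {ω | ∀ ν ≤ m, X ν ω = x ν} =
      ENNReal.ofReal ((if x 0 = Finset.univ then 1 else 0) *
        ∏ ν ∈ Finset.range m, shockTransition r (x ν) (x (ν + 1)))

/-- The shock number to failure `inf {ν ≥ 1 | the state after ν shocks is failed}` (with the value
`0` if the system never fails). -/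
def shockNumberToFailure (k : ℕ) (BC : Finset (Fin n) → Prop) (X : ℕ → Ω → Finset (Fin n))
    (ω : Ω) : ℕ :=
  sInf {ν | 1 ≤ ν ∧ ¬ Nonfailed k BC (X ν ω)}

end BalancedSystem

end

/-!
The compound sum is recognized by its characteristic function, because that of a phase-type law
solves a resolvent equation. Writing `exp (t T)` for the semigroup of the transient states, the
survival function of the law is `α exp (t T) e`, so the law has the density `-α exp (t T) T e`
(`IsPHc.map_eq_phLaw`, `isPHc_of_map_eq_phLaw`). The semigroup decays exponentially: the mean
absorption times `w = -T⁻¹ e` are positive and act as a Lyapunov function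
(`IsSubgenerator.exists_exp_bound`). Therefore `e^{iθz} exp (z T) w` can be integrated by the
fundamental theorem of calculus, which shows that the characteristic function of `PH_c(α, T)` at
`θ` is `α w` for any `w` with `(T + iθ) w = T e` (`charFun_phLaw`), and repeated integration by
parts gives the moments (`IsPHc.hasPHMoments`).

For the random sum, conditioning on `M` gives the characteristic function `∑ P(M = m) φ ^ m`, where
`φ = α_c y` with `(T_c + iθ) y = T_c e` is that of a summand. As
`P(M = m + 1) = α_d T_d ^ m (e - T_d e)`, it equals `φ α_d u` for the vector
`u = ∑ φ ^ m T_d ^ m (e - T_d e)`, which satisfies `u = (e - T_d e) + φ T_d u`. These two equations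
say precisely that `w = u ⊗ y` solves `(T_Z + iθ) w = T_Z e` (`shifted_compound_mulVec`), and
`(α_d ⊗ α_c) w = φ α_d u`. So the sum and `PH_c(α_Z, T_Z)` have the same characteristic function,
hence the same law (`IsPHd.isPHc_randomSum`).

For the balanced system, summing the path probabilities from the last step backwards gives
`P_BC ^ m e` for the probabilities of surviving `m` shocks
(`IsStateProcess.measureReal_path_nonfailed`). The matrix `I - P_BC` is invertible because `P_BC`
is triangular for inclusion of states with diagonal entries `r ^ |a| < 1`; the same fact makes the
survival probabilities tend to `0`, so that the failure time is almost surely finite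
(`IsStateProcess.isPHd_shockNumberToFailure`).
-/

namespace PhaseType

open Filter Topology Set

variable {ι κ : Type*} [Fintype ι] [DecidableEq ι] [Fintype κ] [DecidableEq κ]

/-! ### The semigroup generated by a subgenerator -/

section Semigroup

open scoped Matrix.Norms.Operator

/-- The matrix `exp (t T)`, whose entries are the transition probabilities over a period of length
`t` between the transient states. -/
noncomputable def semigroup (T : Matrix ι ι ℝ) (t : ℝ) : Matrix ι ι ℝ := NormedSpace.exp (t • T)

lemma semigroup_zero (T : Matrix ι ι ℝ) : semigroup T 0 = 1 := by
  simp [semigroup, NormedSpace.exp_zero]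

lemma semigroup_add (T : Matrix ι ι ℝ) (s t : ℝ) :
    semigroup T (s + t) = semigroup T s * semigroup T t := by
  unfold semigroup
  rw [add_smul]
  exact Matrix.exp_add_of_commute _ _ (((Commute.refl T).smul_left s).smul_right t)

lemma hasSum_exp_apply (A : Matrix ι ι ℝ) (i j : ι) :
    HasSum (fun n : ℕ => (n.factorial : ℝ)⁻¹ * (A ^ n) i j) (NormedSpace.exp A i j) := by
  have h := NormedSpace.exp_series_hasSum_exp' (𝕂 := ℝ) A
  have h2 := Pi.hasSum.1 (Pi.hasSum.1 h i) j
  simp only [Matrix.smul_apply, smul_eq_mul] at h2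
  exact h2

lemma hasDerivAt_semigroup_apply (T : Matrix ι ι ℝ) (t : ℝ) (i j : ι) :
    HasDerivAt (fun s => semigroup T s i j) ((semigroup T t * T) i j) t := by
  have h : HasDerivAt (fun s => semigroup T s) (semigroup T t * T) t :=
    hasDerivAt_exp_smul_const T t
  exact hasDerivAt_pi.1 (hasDerivAt_pi.1 h i) j

end Semigroup

lemma pow_mul_of_intertwine {A : Matrix ι ι ℝ} {B : Matrix κ κ ℝ} {P : Matrix ι κ ℝ}
    (h : A * P = P * B) (n : ℕ) : A ^ n * P = P * B ^ n := by
  induction n with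
  | zero => simp
  | succ n ih =>
    rw [pow_succ, Matrix.mul_assoc, h, ← Matrix.mul_assoc, ih, Matrix.mul_assoc, ← pow_succ]

/-- A rectangular matrix intertwining `A` and `B` intertwines their exponentials. -/
lemma exp_mul_of_intertwine {A : Matrix ι ι ℝ} {B : Matrix κ κ ℝ} {P : Matrix ι κ ℝ}
    (h : A * P = P * B) : NormedSpace.exp A * P = P * NormedSpace.exp B := by
  ext i j
  have h1 : HasSum (fun n : ℕ => (n.factorial : ℝ)⁻¹ * (A ^ n * P) i j)
      ((NormedSpace.exp A * P) i j) := by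
    simp only [Matrix.mul_apply, Finset.mul_sum, ← mul_assoc]
    exact hasSum_sum fun k _ => (hasSum_exp_apply A i k).mul_right _
  have h2 : HasSum (fun n : ℕ => (n.factorial : ℝ)⁻¹ * (P * B ^ n) i j)
      ((P * NormedSpace.exp B) i j) := by
    simp only [Matrix.mul_apply, Finset.mul_sum, mul_left_comm _ (P i _)]
    exact hasSum_sum fun k _ => (hasSum_exp_apply B k j).mul_left _
  simp only [pow_mul_of_intertwine h] at h1
  exact h1.unique h2

lemma hasDerivAt_semigroup_mulVec (T : Matrix ι ι ℝ) (v : ι → ℝ) (t : ℝ) (i : ι) :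
    HasDerivAt (fun s => (semigroup T s *ᵥ v) i) ((semigroup T t *ᵥ (T *ᵥ v)) i) t := by
  rw [Matrix.mulVec_mulVec]
  simp only [Matrix.mulVec, dotProduct]
  exact HasDerivAt.fun_sum fun j _ => (hasDerivAt_semigroup_apply T t i j).mul_const _

lemma continuous_semigroup_apply (T : Matrix ι ι ℝ) (i j : ι) :
    Continuous fun t => semigroup T t i j :=
  continuous_iff_continuousAt.2 fun t => (hasDerivAt_semigroup_apply T t i j).continuousAt

lemma continuous_semigroup_mulVec (T : Matrix ι ι ℝ) (v : ι → ℝ) (i : ι) :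
    Continuous fun t => (semigroup T t *ᵥ v) i :=
  continuous_iff_continuousAt.2 fun t => (hasDerivAt_semigroup_mulVec T v t i).continuousAt

lemma pow_apply_nonneg {A : Matrix ι ι ℝ} (hA : ∀ i j, 0 ≤ A i j) (n : ℕ) :
    ∀ i j, 0 ≤ (A ^ n) i j := by
  induction n with
  | zero => intro i j; rw [pow_zero, Matrix.one_apply]; split_ifs <;> norm_num
  | succ n ih =>
    intro i j
    rw [pow_succ, Matrix.mul_apply]
    exact Finset.sum_nonneg fun k _ => mul_nonneg (ih i k) (hA k j)

lemma mulVec_mono {m : Type*} [Fintype m] {A : Matrix m m ℝ} (hA : ∀ i j, 0 ≤ A i j) {v w : m → ℝ}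
    (h : ∀ i, v i ≤ w i) (i : m) : (A *ᵥ v) i ≤ (A *ᵥ w) i :=
  Finset.sum_le_sum fun j _ => mul_le_mul_of_nonneg_left (h j) (hA i j)

lemma mulVec_nonneg {m : Type*} [Fintype m] {A : Matrix m m ℝ} (hA : ∀ i j, 0 ≤ A i j) {v : m → ℝ}
    (h : ∀ i, 0 ≤ v i) (i : m) : 0 ≤ (A *ᵥ v) i :=
  Finset.sum_nonneg fun j _ => mul_nonneg (hA i j) (h j)

lemma eq_zero_of_mulVec_eq_zero {A : Matrix ι ι ℝ} (hA : IsUnit A) {v : ι → ℝ}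
    (h : A *ᵥ v = 0) : v = 0 :=
  Matrix.mulVec_injective_iff_isUnit.2 hA (by simp [h])

lemma IsSubgenerator.mulVec_one_nonpos {T : Matrix ι ι ℝ} (hT : IsSubgenerator T) (i : ι) :
    (T *ᵥ 1) i ≤ 0 := by
  simpa [Matrix.mulVec, dotProduct] using hT.row_sum_le i

/-- After adding a large multiple of the identity, `T` becomes a nonnegative matrix, and the two
exponentials differ by a positive scalar factor. -/
lemma IsSubgenerator.semigroup_nonneg {T : Matrix ι ι ℝ} (hT : IsSubgenerator T) {t : ℝ}
    (ht : 0 ≤ t) (i j : ι) : 0 ≤ semigroup T t i j := by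
  set c : ℝ := ∑ k, |T k k| with hc
  have hB : ∀ k l, 0 ≤ (T + c • (1 : Matrix ι ι ℝ)) k l := by
    intro k l
    by_cases hkl : k = l
    · subst hkl
      have h1 : |T k k| ≤ c :=
        Finset.single_le_sum (f := fun k => |T k k|) (fun _ _ => abs_nonneg _) (Finset.mem_univ k)
      have h2 := neg_abs_le (T k k)
      simp
      linarith
    · simpa [Matrix.one_apply, hkl] using hT.offDiag_nonneg k l hkl
  have hexp : 0 ≤ NormedSpace.exp (t • (T + c • (1 : Matrix ι ι ℝ))) i j := by
    refine (hasSum_exp_apply _ i j).nonneg fun n => mul_nonneg (by positivity) ?_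
    refine pow_apply_nonneg (fun k l => ?_) n i j
    rw [Matrix.smul_apply, smul_eq_mul]
    exact mul_nonneg ht (hB k l)
  have hscal : NormedSpace.exp ((t * c) • (1 : Matrix ι ι ℝ))
      = Real.exp (t * c) • (1 : Matrix ι ι ℝ) := by
    rw [← Matrix.diagonal_one, ← Matrix.diagonal_smul, Matrix.exp_diagonal, ← Matrix.diagonal_smul]
    congr 1
    ext k
    simp [Pi.coe_exp, Real.exp_eq_exp_ℝ]
  rw [smul_add, smul_smul, Matrix.exp_add_of_commute _ _
    ((Commute.one_right _).smul_right _), hscal] at hexp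
  simp only [mul_smul_comm, mul_one, Matrix.smul_apply, smul_eq_mul] at hexp
  exact nonneg_of_mul_nonneg_right hexp (Real.exp_pos _)

/-- Absorption is certain: the survival probabilities `exp (t T) e` decrease to a limit `v` which is
fixed by the semigroup, so that `T v = 0` and hence `v = 0`. -/
lemma IsSubgenerator.tendsto_semigroup_mulVec_one {T : Matrix ι ι ℝ} (hT : IsSubgenerator T)
    (i : ι) : Tendsto (fun t => (semigroup T t *ᵥ 1) i) atTop (𝓝 0) := by
  have hanti : ∀ i, AntitoneOn (fun t => (semigroup T t *ᵥ 1) i) (Ici 0) := by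
    intro i
    refine antitoneOn_of_deriv_nonpos (convex_Ici 0)
      (continuous_semigroup_mulVec T 1 i).continuousOn
      (fun t _ => (hasDerivAt_semigroup_mulVec T 1 t i).differentiableAt.differentiableWithinAt) ?_
    intro t ht
    rw [interior_Ici] at ht
    rw [(hasDerivAt_semigroup_mulVec T 1 t i).deriv]
    have := mulVec_mono (fun i j => hT.semigroup_nonneg (le_of_lt ht) i j)
      (w := 0) (fun j => hT.mulVec_one_nonpos j) i
    simpa using this
  have hlim : ∀ i, ∃ l, Tendsto (fun t => (semigroup T t *ᵥ 1) i) atTop (𝓝 l) := by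
    intro i
    have hA : Antitone fun t : ℝ => (semigroup T (max t 0) *ᵥ 1) i := fun s t hst =>
      hanti i (mem_Ici.2 (le_max_right _ _)) (mem_Ici.2 (le_max_right _ _)) (max_le_max_right 0 hst)
    have hbdd : BddBelow (range fun t : ℝ => (semigroup T (max t 0) *ᵥ 1) i) := by
      refine ⟨0, ?_⟩
      rintro _ ⟨t, rfl⟩
      exact mulVec_nonneg (hT.semigroup_nonneg (le_max_right _ _)) (fun _ => zero_le_one) i
    refine ⟨_, (tendsto_atTop_ciInf hA hbdd).congr' ?_⟩
    filter_upwards [eventually_ge_atTop 0] with t ht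
    rw [max_eq_left ht]
  choose v hv using hlim
  have hfix : ∀ s, semigroup T s *ᵥ v = v := by
    intro s
    ext i
    have h1 : Tendsto (fun t => (semigroup T (s + t) *ᵥ 1) i) atTop (𝓝 (v i)) :=
      (hv i).comp (tendsto_atTop_add_const_left _ s tendsto_id)
    have h2 : Tendsto (fun t => (semigroup T (s + t) *ᵥ 1) i) atTop
        (𝓝 ((semigroup T s *ᵥ v) i)) := by
      simp only [semigroup_add, ← Matrix.mulVec_mulVec]
      exact tendsto_finsetSum _ fun j _ => (hv j).const_mul _
    exact tendsto_nhds_unique h2 h1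
  have hTv : T *ᵥ v = 0 := by
    ext i
    have h1 := hasDerivAt_semigroup_mulVec T v 0 i
    simp only [hfix, semigroup_zero, Matrix.one_mulVec] at h1
    exact h1.unique (hasDerivAt_const _ _)
  have h0 := eq_zero_of_mulVec_eq_zero hT.isUnit hTv
  simpa [h0] using hv i

lemma IsSubgenerator.tendsto_semigroup_apply {T : Matrix ι ι ℝ} (hT : IsSubgenerator T)
    (i j : ι) : Tendsto (fun t => semigroup T t i j) atTop (𝓝 0) := by
  refine squeeze_zero' ?_ ?_ (hT.tendsto_semigroup_mulVec_one i)
  · filter_upwards [eventually_ge_atTop 0] with t ht using hT.semigroup_nonneg ht i j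
  · filter_upwards [eventually_ge_atTop 0] with t ht
    simp only [Matrix.mulVec, dotProduct, Pi.one_apply, mul_one]
    exact Finset.single_le_sum (f := fun j => semigroup T t i j)
      (fun k _ => hT.semigroup_nonneg ht i k) (Finset.mem_univ j)

/-- The vector of mean absorption times `w = -T⁻¹ e` is positive and solves `T w = -e`. -/
lemma IsSubgenerator.exists_meanTime {T : Matrix ι ι ℝ} (hT : IsSubgenerator T) :
    ∃ w : ι → ℝ, T *ᵥ w = -1 ∧ ∀ i, 0 < w i := by
  obtain ⟨w, hw⟩ := Matrix.mulVec_surjective_iff_isUnit.2 hT.isUnit (-1)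
  have hnonneg : ∀ i, 0 ≤ w i := by
    intro i
    have hanti : AntitoneOn (fun t => (semigroup T t *ᵥ w) i) (Ici 0) := by
      refine antitoneOn_of_deriv_nonpos (convex_Ici 0)
        (continuous_semigroup_mulVec T w i).continuousOn
        (fun t _ => (hasDerivAt_semigroup_mulVec T w t i).differentiableAt.differentiableWithinAt)
        ?_
      intro t ht
      rw [interior_Ici] at ht
      rw [(hasDerivAt_semigroup_mulVec T w t i).deriv, hw, Matrix.mulVec_neg, Pi.neg_apply,
        neg_nonpos]
      exact mulVec_nonneg (hT.semigroup_nonneg (le_of_lt ht)) (fun _ => zero_le_one) i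
    have hlim : Tendsto (fun t => (semigroup T t *ᵥ w) i) atTop (𝓝 0) := by
      have := tendsto_finsetSum Finset.univ
        (fun j _ => (hT.tendsto_semigroup_apply i j).mul_const (w j))
      simpa [Matrix.mulVec, dotProduct] using this
    refine le_of_tendsto hlim ?_
    filter_upwards [eventually_ge_atTop 0] with t ht
    have := hanti (mem_Ici.2 le_rfl) (mem_Ici.2 ht) ht
    simpa [semigroup_zero] using this
  refine ⟨w, hw, fun i => (hnonneg i).lt_of_ne fun h0 => ?_⟩
  -- at a zero of `w` only the nonnegative off-diagonal entries of `T` would contribute to `T w`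
  have h1 : 0 ≤ (T *ᵥ w) i := by
    refine Finset.sum_nonneg fun j _ => ?_
    by_cases hij : i = j
    · subst hij; simp [← h0]
    · exact mul_nonneg (hT.offDiag_nonneg i j hij) (hnonneg j)
  rw [hw] at h1
  norm_num at h1

/-- Exponential decay of the semigroup. The vector `w` of mean absorption times is a Lyapunov
function: `w ≤ C e` gives `T w = -e ≤ -w / C`, so that `exp (t T) w ≤ exp (-t / C) w`. -/
lemma IsSubgenerator.exists_exp_bound {T : Matrix ι ι ℝ} (hT : IsSubgenerator T) :
    ∃ c > 0, ∃ K, ∀ t, 0 ≤ t → ∀ i j, semigroup T t i j ≤ K * Real.exp (-c * t) := by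
  obtain ⟨w, hw, hpos⟩ := hT.exists_meanTime
  -- `C` and `K` are such that `w ≤ C e` and `e ≤ K w`
  set C : ℝ := 1 + ∑ i, w i with hC
  have hsum : 0 ≤ ∑ i, w i := Finset.sum_nonneg fun i _ => (hpos i).le
  have hwC : ∀ i, w i ≤ C := fun i => by
    have := Finset.single_le_sum (f := w) (fun i _ => (hpos i).le) (Finset.mem_univ i)
    linarith
  have hCpos : 0 < C := by linarith
  set K : ℝ := ∑ i, (w i)⁻¹ with hK
  have hwK : ∀ i, 1 ≤ K * w i := fun i => by
    have h1 := Finset.single_le_sum (f := fun i => (w i)⁻¹)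
      (fun i _ => (inv_pos.2 (hpos i)).le) (Finset.mem_univ i)
    calc (1 : ℝ) = (w i)⁻¹ * w i := (inv_mul_cancel₀ (hpos i).ne').symm
      _ ≤ K * w i := mul_le_mul_of_nonneg_right h1 (hpos i).le
  have hKnn : 0 ≤ K := Finset.sum_nonneg fun i _ => (inv_pos.2 (hpos i)).le
  have hdecay : ∀ i t, 0 ≤ t → (semigroup T t *ᵥ w) i ≤ w i * Real.exp (-C⁻¹ * t) := by
    intro i t ht
    have hd : ∀ s, HasDerivAt (fun s => Real.exp (C⁻¹ * s) * (semigroup T s *ᵥ w) i)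
        (Real.exp (C⁻¹ * s) * C⁻¹ * (semigroup T s *ᵥ w) i
          + Real.exp (C⁻¹ * s) * (semigroup T s *ᵥ (T *ᵥ w)) i) s := fun s =>
      HasDerivAt.mul (by simpa using ((hasDerivAt_id s).const_mul C⁻¹).exp)
        (hasDerivAt_semigroup_mulVec T w s i)
    have hanti : AntitoneOn (fun s => Real.exp (C⁻¹ * s) * (semigroup T s *ᵥ w) i) (Ici 0) := by
      refine antitoneOn_of_deriv_nonpos (convex_Ici 0)
        (fun s _ => (hd s).continuousAt.continuousWithinAt)
        (fun s _ => (hd s).differentiableAt.differentiableWithinAt) ?_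
      intro s hs
      rw [interior_Ici] at hs
      rw [(hd s).deriv, hw, Matrix.mulVec_neg, Pi.neg_apply, mul_assoc, ← mul_add]
      refine mul_nonpos_of_nonneg_of_nonpos (Real.exp_pos _).le ?_
      have h1 := mulVec_mono (hT.semigroup_nonneg (le_of_lt hs)) (v := w) (w := C • 1)
        (fun j => by simpa using hwC j) i
      rw [Matrix.mulVec_smul, Pi.smul_apply, smul_eq_mul] at h1
      have h2 := mul_le_mul_of_nonneg_left h1 (inv_pos.2 hCpos).le
      rw [inv_mul_cancel_left₀ hCpos.ne'] at h2
      linarith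
    have h := hanti (mem_Ici.2 le_rfl) (mem_Ici.2 ht) ht
    simp only [mul_zero, Real.exp_zero, semigroup_zero, Matrix.one_mulVec, one_mul] at h
    rw [neg_mul, Real.exp_neg, ← div_eq_mul_inv, le_div_iff₀ (Real.exp_pos _)]
    linarith
  refine ⟨C⁻¹, inv_pos.2 hCpos, K * C, fun t ht i j => ?_⟩
  have h1 : semigroup T t i j ≤ (semigroup T t *ᵥ 1) i := by
    simp only [Matrix.mulVec, dotProduct, Pi.one_apply, mul_one]
    exact Finset.single_le_sum (f := fun j => semigroup T t i j)
      (fun k _ => hT.semigroup_nonneg ht i k) (Finset.mem_univ j)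
  have h2 := mulVec_mono (hT.semigroup_nonneg ht) (v := 1) (w := K • w)
    (fun j => by simpa using hwK j) i
  rw [Matrix.mulVec_smul, Pi.smul_apply, smul_eq_mul] at h2
  calc semigroup T t i j ≤ K * (semigroup T t *ᵥ w) i := h1.trans h2
    _ ≤ K * (w i * Real.exp (-C⁻¹ * t)) := mul_le_mul_of_nonneg_left (hdecay i t ht) hKnn
    _ ≤ K * (C * Real.exp (-C⁻¹ * t)) := by
      gcongr
      exact hwC i
    _ = K * C * Real.exp (-C⁻¹ * t) := by ring

/-- Powers do not spoil the exponential decay of the semigroup. -/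
lemma IsSubgenerator.pow_mul_semigroup_isBigO {T : Matrix ι ι ℝ} (hT : IsSubgenerator T) :
    ∃ b > 0, ∀ (p : ℕ) (i j : ι),
      (fun t => t ^ p * semigroup T t i j) =O[atTop] fun t => Real.exp (-b * t) := by
  obtain ⟨c, hc, K, hK⟩ := hT.exists_exp_bound
  refine ⟨c / 2, half_pos hc, fun p i j => ?_⟩
  have h1 : (fun t => semigroup T t i j) =O[atTop] fun t => Real.exp (-c * t) := by
    refine Asymptotics.IsBigO.of_bound K ?_
    filter_upwards [eventually_ge_atTop 0] with t ht
    rw [Real.norm_of_nonneg (hT.semigroup_nonneg ht i j), Real.norm_of_nonneg (Real.exp_pos _).le]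
    exact hK t ht i j
  have h2 := (isLittleO_pow_exp_pos_mul_atTop p (half_pos hc)).isBigO.mul h1
  refine h2.congr_right fun t => ?_
  rw [← Real.exp_add]
  ring_nf

lemma IsSubgenerator.integrableOn_pow_mul_semigroup {T : Matrix ι ι ℝ} (hT : IsSubgenerator T)
    (p : ℕ) (i j : ι) : IntegrableOn (fun t => t ^ p * semigroup T t i j) (Ioi 0) := by
  obtain ⟨b, hb, h⟩ := hT.pow_mul_semigroup_isBigO
  exact integrable_of_isBigO_exp_neg hb
    ((continuous_pow p).mul (continuous_semigroup_apply T i j)).continuousOn (h p i j)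

lemma IsSubgenerator.tendsto_pow_mul_semigroup {T : Matrix ι ι ℝ} (hT : IsSubgenerator T)
    (p : ℕ) (i j : ι) : Tendsto (fun t => t ^ p * semigroup T t i j) atTop (𝓝 0) := by
  obtain ⟨b, hb, h⟩ := hT.pow_mul_semigroup_isBigO
  refine (h p i j).trans_tendsto ?_
  have h1 : Tendsto (fun t : ℝ => b * t) atTop atTop := tendsto_id.const_mul_atTop hb
  simpa only [neg_mul, Function.comp_def] using Real.tendsto_exp_neg_atTop_nhds_zero.comp h1

end PhaseType

namespace PhaseType

open Filter Topology Set

variable {ι κ : Type*} [Fintype ι] [DecidableEq ι] [Fintype κ] [DecidableEq κ]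

/-! ### The absorbing chains in terms of their transient parts -/

/-- If the transient block of a stochastic matrix `A` on `ι ⊕ Unit` is `S`, the mass which `A`
moves to the absorbing state is what `S` loses. -/
lemma absorbingInit_vecMul_inr {α : ι → ℝ} (hα : IsProbVec α)
    {A : Matrix (ι ⊕ Unit) (ι ⊕ Unit) ℝ} {S : Matrix ι ι ℝ}
    (hS : A * Matrix.fromRows (1 : Matrix ι ι ℝ) (0 : Matrix Unit ι ℝ)
      = Matrix.fromRows (1 : Matrix ι ι ℝ) (0 : Matrix Unit ι ℝ) * S)
    (hA : A *ᵥ 1 = 1) :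
    (absorbingInit α ᵥ* A) (Sum.inr ()) = 1 - α ⬝ᵥ (S *ᵥ 1) := by
  have h1 : ∀ i j, A (Sum.inl i) (Sum.inl j) = S i j := by
    intro i j
    have := congrFun (congrFun hS (Sum.inl i)) j
    simpa [Matrix.mul_apply, Matrix.one_apply] using this
  have h2 : ∀ i, ∑ j, S i j + A (Sum.inl i) (Sum.inr ()) = 1 := by
    intro i
    have := congrFun hA (Sum.inl i)
    simpa only [Matrix.mulVec, dotProduct, Pi.one_apply, mul_one, Fintype.sum_sum_type, h1,
      Finset.univ_unique, Finset.sum_singleton, PUnit.default_eq_unit] using this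
  have h3 : ∀ i, A (Sum.inl i) (Sum.inr ()) = 1 - (S *ᵥ 1) i := by
    intro i
    have := h2 i
    simp only [Matrix.mulVec, dotProduct, Pi.one_apply, mul_one]
    linarith
  simp only [Matrix.vecMul, dotProduct, absorbingInit, Fintype.sum_sum_type, Sum.elim_inl,
    Sum.elim_inr, Pi.zero_apply, zero_mul, Finset.sum_const_zero, add_zero, h3]
  simp [mul_sub, Finset.sum_sub_distrib, hα.sum_eq_one]

lemma absorbingTransition_pow_inr {α : ι → ℝ} (hα : IsProbVec α) (T : Matrix ι ι ℝ) (m : ℕ) :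
    (absorbingInit α ᵥ* absorbingTransition T ^ m) (Sum.inr ()) = 1 - α ⬝ᵥ ((T ^ m) *ᵥ 1) := by
  refine absorbingInit_vecMul_inr hα (pow_mul_of_intertwine ?_ m) ?_
  · ext (i | i) j <;>
      simp [absorbingTransition, Matrix.mul_apply, Matrix.one_apply]
  · have h : absorbingTransition T * (Matrix.of fun _ _ => 1 : Matrix (ι ⊕ Unit) Unit ℝ)
        = (Matrix.of fun _ _ => 1 : Matrix (ι ⊕ Unit) Unit ℝ) * (1 : Matrix Unit Unit ℝ) := by
      ext (i | i) j <;> rw [Matrix.mul_apply, Matrix.mul_apply] <;>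
        simp [absorbingTransition, Matrix.mulVec, dotProduct]
    have h2 := pow_mul_of_intertwine h m
    ext i
    simpa [Matrix.mul_apply, Matrix.mulVec, dotProduct] using congrFun (congrFun h2 i) ()

lemma exp_absorbingGenerator_inr {α : ι → ℝ} (hα : IsProbVec α) (T : Matrix ι ι ℝ) (t : ℝ) :
    (absorbingInit α ᵥ* NormedSpace.exp (t • absorbingGenerator T)) (Sum.inr ())
      = 1 - α ⬝ᵥ (semigroup T t *ᵥ 1) := by
  refine absorbingInit_vecMul_inr hα (exp_mul_of_intertwine ?_) ?_
  · ext (i | i) j <;>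
      simp [absorbingGenerator, Matrix.mul_apply, Matrix.one_apply]
  · have h : (t • absorbingGenerator T) * (Matrix.of fun _ _ => 1 : Matrix (ι ⊕ Unit) Unit ℝ)
        = (Matrix.of fun _ _ => 1 : Matrix (ι ⊕ Unit) Unit ℝ) * (0 : Matrix Unit Unit ℝ) := by
      ext (i | i) j <;> rw [Matrix.mul_apply, Matrix.mul_apply] <;>
        simp [absorbingGenerator, Matrix.mulVec, dotProduct, ← Finset.mul_sum]
    have h2 := exp_mul_of_intertwine h
    ext i
    simpa [Matrix.mul_apply, Matrix.mulVec, dotProduct, NormedSpace.exp_zero] using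
      congrFun (congrFun h2 i) ()

/-! ### The phase-type law -/

/-- The phase-type law `PH_c(α, T)`, given by its density on `[0, ∞)`. -/
noncomputable def phLaw (α : ι → ℝ) (T : Matrix ι ι ℝ) : Measure ℝ :=
  (volume.restrict (Ici 0)).withDensity fun z => ENNReal.ofReal (phDensity α T z)

lemma phDensity_eq_sum (α : ι → ℝ) (T : Matrix ι ι ℝ) (z : ℝ) :
    phDensity α T z = -∑ i, α i * (semigroup T z *ᵥ (T *ᵥ 1)) i := by
  rw [Matrix.mulVec_mulVec]
  rfl

lemma hasDerivAt_dotProduct_semigroup (α : ι → ℝ) (T : Matrix ι ι ℝ) (z : ℝ) :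
    HasDerivAt (fun z => -(α ⬝ᵥ (semigroup T z *ᵥ 1))) (phDensity α T z) z := by
  rw [phDensity_eq_sum]
  exact (HasDerivAt.fun_sum fun i _ => (hasDerivAt_semigroup_mulVec T 1 z i).const_mul (α i)).neg

lemma continuous_phDensity (α : ι → ℝ) (T : Matrix ι ι ℝ) : Continuous (phDensity α T) := by
  have h : phDensity α T = fun z => -∑ i, α i * (semigroup T z *ᵥ (T *ᵥ 1)) i :=
    funext (phDensity_eq_sum α T)
  rw [h]
  exact (continuous_finsetSum _ fun i _ =>
    continuous_const.mul (continuous_semigroup_mulVec T _ i)).neg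

lemma phDensity_nonneg {α : ι → ℝ} (hα : IsProbVec α) {T : Matrix ι ι ℝ} (hT : IsSubgenerator T)
    {z : ℝ} (hz : 0 ≤ z) : 0 ≤ phDensity α T z := by
  rw [phDensity_eq_sum, ← Finset.sum_neg_distrib]
  refine Finset.sum_nonneg fun i _ => ?_
  have := mulVec_mono (hT.semigroup_nonneg hz) (w := 0) hT.mulVec_one_nonpos i
  rw [Matrix.mulVec_zero, Pi.zero_apply] at this
  rw [← mul_neg]
  exact mul_nonneg (hα.nonneg i) (neg_nonneg.2 this)

lemma phLaw_Iic {α : ι → ℝ} (hα : IsProbVec α) {T : Matrix ι ι ℝ} (hT : IsSubgenerator T)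
    {t : ℝ} (ht : 0 ≤ t) :
    phLaw α T (Iic t) = ENNReal.ofReal (1 - α ⬝ᵥ (semigroup T t *ᵥ 1)) := by
  have hset : Iic t ∩ Ici 0 = Icc 0 t := by ext; simp [and_comm]
  rw [phLaw, withDensity_apply _ measurableSet_Iic, Measure.restrict_restrict measurableSet_Iic,
    hset, ← ofReal_integral_eq_lintegral_ofReal
      ((continuous_phDensity α T).continuousOn.integrableOn_Icc)
      ((ae_restrict_iff' measurableSet_Icc).2
        (Eventually.of_forall fun z hz => phDensity_nonneg hα hT hz.1)),
    integral_Icc_eq_integral_Ioc, ← intervalIntegral.integral_of_le ht,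
    intervalIntegral.integral_eq_sub_of_hasDerivAt
      (fun z _ => hasDerivAt_dotProduct_semigroup α T z)
      ((continuous_phDensity α T).intervalIntegrable _ _)]
  congr 1
  simp only [semigroup_zero, Matrix.one_mulVec, dotProduct_one, hα.sum_eq_one]
  ring

lemma phLaw_Iic_of_neg (α : ι → ℝ) (T : Matrix ι ι ℝ) {t : ℝ} (ht : t < 0) :
    phLaw α T (Iic t) = 0 := by
  have hset : Iic t ∩ Ici 0 = ∅ := by
    ext x
    simp only [mem_inter_iff, mem_Iic, mem_Ici, mem_empty_iff_false, iff_false, not_and, not_le]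
    intro h; linarith
  rw [phLaw, withDensity_apply _ measurableSet_Iic, Measure.restrict_restrict measurableSet_Iic,
    hset]
  simp

lemma isProbabilityMeasure_phLaw {α : ι → ℝ} (hα : IsProbVec α) {T : Matrix ι ι ℝ}
    (hT : IsSubgenerator T) : IsProbabilityMeasure (phLaw α T) := by
  have h1 : Tendsto (fun t : ℝ => phLaw α T (Iic t)) atTop (𝓝 (phLaw α T univ)) :=
    tendsto_measure_Iic_atTop _
  have h2 : Tendsto (fun t => 1 - α ⬝ᵥ (semigroup T t *ᵥ 1)) atTop (𝓝 1) := by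
    have := tendsto_finsetSum Finset.univ
      (fun i _ => (hT.tendsto_semigroup_mulVec_one i).const_mul (α i))
    simpa [dotProduct] using this.const_sub 1
  have h3 := ENNReal.tendsto_ofReal h2
  rw [ENNReal.ofReal_one] at h3
  refine ⟨tendsto_nhds_unique h1 (h3.congr' ?_)⟩
  filter_upwards [eventually_ge_atTop 0] with t ht using (phLaw_Iic hα hT ht).symm

variable {Ω : Type*} [MeasurableSpace Ω] {μ : Measure Ω}

lemma IsPHc.map_eq_phLaw [IsProbabilityMeasure μ] {Z : Ω → ℝ} {α : ι → ℝ} {T : Matrix ι ι ℝ}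
    (h : IsPHc Z μ α T) : μ.map Z = phLaw α T := by
  have := isProbabilityMeasure_phLaw h.probVec h.subgenerator
  have := Measure.isProbabilityMeasure_map h.aemeasurable
  have hle : ∀ t, 0 ≤ t → μ.map Z (Iic t) = phLaw α T (Iic t) := by
    intro t ht
    rw [Measure.map_apply_of_aemeasurable h.aemeasurable measurableSet_Iic,
      phLaw_Iic h.probVec h.subgenerator ht, ← exp_absorbingGenerator_inr h.probVec,
      ← h.measure_le t ht]
    rfl
  refine Measure.ext_of_Iic _ _ fun t => ?_
  rcases le_or_gt 0 t with ht | ht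
  · exact hle t ht
  · rw [phLaw_Iic_of_neg α T ht]
    refine measure_mono_null (Iic_subset_Iic.2 ht.le) ?_
    rw [hle 0 le_rfl, phLaw_Iic h.probVec h.subgenerator le_rfl, semigroup_zero,
      Matrix.one_mulVec, dotProduct_one, h.probVec.sum_eq_one]
    simp

lemma isPHc_of_map_eq_phLaw {Z : Ω → ℝ} (hZ : AEMeasurable Z μ) {α : ι → ℝ} (hα : IsProbVec α)
    {T : Matrix ι ι ℝ} (hT : IsSubgenerator T) (h : μ.map Z = phLaw α T) : IsPHc Z μ α T where
  probVec := hα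
  subgenerator := hT
  aemeasurable := hZ
  measure_le t ht := by
    rw [exp_absorbingGenerator_inr hα, ← phLaw_Iic hα hT ht, ← h,
      Measure.map_apply_of_aemeasurable hZ measurableSet_Iic]
    rfl

lemma IsPHc.hasPHDensity [IsProbabilityMeasure μ] {Z : Ω → ℝ} {α : ι → ℝ} {T : Matrix ι ι ℝ}
    (h : IsPHc Z μ α T) : HasPHDensity Z μ α T :=
  ⟨fun _ hz => phDensity_nonneg h.probVec h.subgenerator hz, h.map_eq_phLaw⟩

section Integral

variable {E : Type*} [NormedAddCommGroup E] [NormedSpace ℝ E]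

lemma integral_phLaw {α : ι → ℝ} (hα : IsProbVec α) {T : Matrix ι ι ℝ} (hT : IsSubgenerator T)
    (g : ℝ → E) : ∫ z, g z ∂phLaw α T = ∫ z in Ioi 0, phDensity α T z • g z := by
  rw [phLaw, integral_withDensity_eq_integral_toReal_smul
    (continuous_phDensity α T).measurable.ennreal_ofReal (by simp), integral_Ici_eq_integral_Ioi]
  refine setIntegral_congr_fun measurableSet_Ioi fun z hz => ?_
  simp only [ENNReal.toReal_ofReal (phDensity_nonneg hα hT (le_of_lt hz))]

lemma integrable_phLaw_iff {α : ι → ℝ} (hα : IsProbVec α) {T : Matrix ι ι ℝ}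
    (hT : IsSubgenerator T) (g : ℝ → E) :
    Integrable g (phLaw α T) ↔ IntegrableOn (fun z => phDensity α T z • g z) (Ioi 0) := by
  rw [phLaw, integrable_withDensity_iff_integrable_smul'
    (continuous_phDensity α T).measurable.ennreal_ofReal (by simp), ← IntegrableOn,
    integrableOn_Ici_iff_integrableOn_Ioi]
  refine integrableOn_congr_fun (fun z hz => ?_) measurableSet_Ioi
  simp only [ENNReal.toReal_ofReal (phDensity_nonneg hα hT (le_of_lt hz))]

end Integral

/-! ### Moments -/

lemma IsSubgenerator.integrableOn_pow_mul_mulVec {T : Matrix ι ι ℝ} (hT : IsSubgenerator T)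
    (p : ℕ) (x : ι → ℝ) (i : ι) :
    IntegrableOn (fun t => t ^ p * (semigroup T t *ᵥ x) i) (Ioi 0) := by
  simp only [Matrix.mulVec, dotProduct, Finset.mul_sum, ← mul_assoc]
  exact integrable_finsetSum _ fun j _ => (hT.integrableOn_pow_mul_semigroup p i j).mul_const _

lemma IsSubgenerator.tendsto_pow_mul_mulVec {T : Matrix ι ι ℝ} (hT : IsSubgenerator T)
    (p : ℕ) (x : ι → ℝ) (i : ι) :
    Tendsto (fun t => t ^ p * (semigroup T t *ᵥ x) i) atTop (𝓝 0) := by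
  simp only [Matrix.mulVec, dotProduct, Finset.mul_sum, ← mul_assoc]
  simpa using tendsto_finsetSum Finset.univ
    (fun j _ => (hT.tendsto_pow_mul_semigroup p i j).mul_const (x j))

lemma IsSubgenerator.mulVec_inv_mulVec {T : Matrix ι ι ℝ} (hT : IsSubgenerator T) (x : ι → ℝ) :
    T *ᵥ (T⁻¹ *ᵥ x) = x := by
  rw [Matrix.mulVec_mulVec, Matrix.mul_nonsing_inv _ ((Matrix.isUnit_iff_isUnit_det _).1 hT.isUnit),
    Matrix.one_mulVec]

/-- Repeated integration by parts: `t ^ p exp (t T) T⁻¹` has the derivative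
`p t ^ (p - 1) exp (t T) T⁻¹ + t ^ p exp (t T)`. -/
lemma IsSubgenerator.integral_pow_mul_mulVec {T : Matrix ι ι ℝ} (hT : IsSubgenerator T) (p : ℕ) :
    ∀ (x : ι → ℝ) (i : ι), ∫ t in Ioi 0, t ^ p * (semigroup T t *ᵥ x) i
      = p.factorial * (((-T⁻¹) ^ (p + 1)) *ᵥ x) i := by
  induction p with
  | zero =>
    intro x i
    have h := integral_Ioi_of_hasDerivAt_of_tendsto'
      (fun t _ => by
        have := hasDerivAt_semigroup_mulVec T (T⁻¹ *ᵥ x) t i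
        rwa [hT.mulVec_inv_mulVec] at this)
      (by simpa using hT.integrableOn_pow_mul_mulVec 0 x i)
      (by simpa using hT.tendsto_pow_mul_mulVec 0 (T⁻¹ *ᵥ x) i) (a := 0)
    simp only [semigroup_zero, Matrix.one_mulVec] at h
    simp [h, Matrix.neg_mulVec]
  | succ p ih =>
    intro x i
    have hint1 : IntegrableOn
        (fun t => ((p + 1 : ℕ) : ℝ) * (t ^ p * (semigroup T t *ᵥ (T⁻¹ *ᵥ x)) i)) (Ioi 0) :=
      (hT.integrableOn_pow_mul_mulVec p _ i).const_mul _
    have hint2 := hT.integrableOn_pow_mul_mulVec (p + 1) x i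
    have h := integral_Ioi_of_hasDerivAt_of_tendsto'
      (f' := fun t => ((p + 1 : ℕ) : ℝ) * (t ^ p * (semigroup T t *ᵥ (T⁻¹ *ᵥ x)) i)
        + t ^ (p + 1) * (semigroup T t *ᵥ x) i)
      (fun t _ => by
        have := (hasDerivAt_pow (p + 1) t).fun_mul (hasDerivAt_semigroup_mulVec T (T⁻¹ *ᵥ x) t i)
        rw [hT.mulVec_inv_mulVec] at this
        refine this.congr_deriv ?_
        simp only [Nat.add_sub_cancel]
        ring)
      (hint1.add hint2)
      (hT.tendsto_pow_mul_mulVec (p + 1) (T⁻¹ *ᵥ x) i) (a := 0)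
    rw [integral_add hint1 hint2, integral_const_mul, ih] at h
    have h2 : ((-T⁻¹) ^ (p + 1 + 1)) *ᵥ x = -(((-T⁻¹) ^ (p + 1)) *ᵥ (T⁻¹ *ᵥ x)) := by
      rw [pow_succ _ (p + 1), ← Matrix.mulVec_mulVec, Matrix.neg_mulVec, Matrix.mulVec_neg]
    rw [h2, Pi.neg_apply, Nat.factorial_succ]
    push_cast at h ⊢
    simp only [ne_eq, Nat.succ_ne_zero, not_false_eq_true, zero_pow, zero_mul,
      sub_zero] at h
    linarith

lemma IsPHc.hasPHMoments [IsProbabilityMeasure μ] {Z : Ω → ℝ} {α : ι → ℝ} {T : Matrix ι ι ℝ}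
    (h : IsPHc Z μ α T) : HasPHMoments Z μ α T := by
  have hα := h.probVec
  have hT := h.subgenerator
  intro p _
  have hfun : ∀ z, phDensity α T z • z ^ p
      = ∑ i, -α i * (z ^ p * (semigroup T z *ᵥ (T *ᵥ 1)) i) := by
    intro z
    rw [phDensity_eq_sum, smul_eq_mul, neg_mul, Finset.sum_mul, ← Finset.sum_neg_distrib]
    exact Finset.sum_congr rfl fun i _ => by ring
  have hint : ∀ i ∈ Finset.univ, IntegrableOn
      (fun z => -α i * (z ^ p * (semigroup T z *ᵥ (T *ᵥ 1)) i)) (Ioi 0) := fun i _ =>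
    (hT.integrableOn_pow_mul_mulVec p _ i).const_mul _
  have hpow : AEStronglyMeasurable (fun z : ℝ => z ^ p) (μ.map Z) :=
    (continuous_pow p).aestronglyMeasurable
  have hmom : ((-T⁻¹) ^ (p + 1)) *ᵥ (T *ᵥ 1) = -(((-T⁻¹) ^ p) *ᵥ 1) := by
    rw [pow_succ, ← Matrix.mulVec_mulVec, Matrix.mulVec_mulVec _ _ T, Matrix.neg_mul,
      Matrix.nonsing_inv_mul _ ((Matrix.isUnit_iff_isUnit_det _).1 hT.isUnit), Matrix.neg_mulVec,
      Matrix.one_mulVec, Matrix.mulVec_neg]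
  constructor
  · have : Integrable (fun z : ℝ => z ^ p) (μ.map Z) := by
      rw [h.map_eq_phLaw, integrable_phLaw_iff hα hT]
      simp only [hfun]
      exact integrable_finsetSum _ hint
    exact (integrable_map_measure hpow h.aemeasurable).1 this
  · rw [← integral_map h.aemeasurable hpow, h.map_eq_phLaw, integral_phLaw hα hT]
    simp only [hfun]
    rw [integral_finsetSum _ hint]
    simp only [integral_const_mul, hT.integral_pow_mul_mulVec, hmom, Pi.neg_apply]
    simp only [dotProduct, Finset.mul_sum]
    exact Finset.sum_congr rfl fun i _ => by ring

end PhaseType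

namespace PhaseType

open Filter Topology Set

variable {ι κ : Type*} [Fintype ι] [DecidableEq ι] [Fintype κ] [DecidableEq κ]

/-! ### Characteristic functions of phase-type laws -/

/-- The complex matrix `T + i θ I`. -/
noncomputable def shifted (T : Matrix ι ι ℝ) (θ : ℝ) : Matrix ι ι ℂ :=
  T.map (↑) + ((θ : ℂ) * Complex.I) • (1 : Matrix ι ι ℂ)

lemma shifted_mulVec (T : Matrix ι ι ℝ) (θ : ℝ) (w : ι → ℂ) (i : ι) :
    (shifted T θ *ᵥ w) i = ∑ j, (T i j : ℂ) * w j + θ * Complex.I * w i := by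
  rw [shifted, Matrix.add_mulVec, Matrix.smul_mulVec, Matrix.one_mulVec]
  rfl

lemma norm_cexp_mul_I (θ z : ℝ) : ‖Complex.exp (θ * z * Complex.I)‖ = 1 := by
  rw [← Complex.ofReal_mul, Complex.norm_exp_ofReal_mul_I]

lemma IsSubgenerator.integrableOn_cexp_mul {T : Matrix ι ι ℝ} (hT : IsSubgenerator T) (θ : ℝ)
    (w : ι → ℂ) (i : ι) :
    IntegrableOn (fun z : ℝ => Complex.exp (θ * z * Complex.I) * ∑ j, (semigroup T z i j : ℂ) * w j)
      (Ioi 0) := by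
  have h1 : IntegrableOn (fun z : ℝ => ∑ j, (semigroup T z i j : ℂ) * w j) (Ioi 0) := by
    refine integrable_finsetSum _ fun j _ => Integrable.mul_const ?_ _
    have := hT.integrableOn_pow_mul_semigroup 0 i j
    simp only [pow_zero, one_mul] at this
    exact this.ofReal
  refine Integrable.bdd_mul h1 (c := 1) (Continuous.aestronglyMeasurable (by fun_prop)) ?_
  exact Eventually.of_forall fun z => (norm_cexp_mul_I θ z).le

/-- The fundamental theorem of calculus for `z ↦ e^{iθz} exp(z T) w`, whose derivative is
`e^{iθz} exp(z T) (T + i θ I) w`. -/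
lemma IsSubgenerator.integral_cexp_mul {T : Matrix ι ι ℝ} (hT : IsSubgenerator T) (θ : ℝ)
    (w : ι → ℂ) (i : ι) :
    ∫ z in Ioi (0 : ℝ), Complex.exp (θ * z * Complex.I) *
      ∑ j, (semigroup T z i j : ℂ) * (shifted T θ *ᵥ w) j = -w i := by
  have hderiv : ∀ z : ℝ, HasDerivAt
      (fun z : ℝ => Complex.exp (θ * z * Complex.I) * ∑ j, (semigroup T z i j : ℂ) * w j)
      (Complex.exp (θ * z * Complex.I) *
        ∑ j, (semigroup T z i j : ℂ) * (shifted T θ *ᵥ w) j) z := by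
    intro z
    have h1 : HasDerivAt (fun z : ℝ => Complex.exp (θ * z * Complex.I))
        (Complex.exp (θ * z * Complex.I) * (θ * Complex.I)) z := by
      refine HasDerivAt.cexp ?_
      simpa using ((Complex.ofRealCLM.hasDerivAt (x := z)).const_mul (θ : ℂ)).mul_const Complex.I
    have h2 : HasDerivAt (fun z : ℝ => ∑ j, (semigroup T z i j : ℂ) * w j)
        (∑ j, (((semigroup T z * T) i j : ℝ) : ℂ) * w j) z :=
      HasDerivAt.fun_sum fun j _ => (hasDerivAt_semigroup_apply T z i j).ofReal_comp.mul_const _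
    refine (h1.fun_mul h2).congr_deriv ?_
    rw [mul_assoc, ← mul_add]
    congr 1
    simp only [shifted_mulVec, Matrix.mul_apply, Complex.ofReal_sum, Complex.ofReal_mul,
      Finset.sum_mul, Finset.mul_sum, mul_add, Finset.sum_add_distrib]
    rw [Finset.sum_comm, add_comm]
    congr 1
    · exact Finset.sum_congr rfl fun j _ => Finset.sum_congr rfl fun k _ => by ring
    · exact Finset.sum_congr rfl fun j _ => by ring
  have hlim : Tendsto
      (fun z : ℝ => Complex.exp (θ * z * Complex.I) * ∑ j, (semigroup T z i j : ℂ) * w j)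
      atTop (𝓝 0) := by
    rw [tendsto_zero_iff_norm_tendsto_zero]
    simp only [norm_mul, norm_cexp_mul_I, one_mul]
    rw [← tendsto_zero_iff_norm_tendsto_zero]
    have := tendsto_finsetSum Finset.univ fun j _ =>
      ((Complex.continuous_ofReal.tendsto 0).comp (hT.tendsto_semigroup_apply i j)).mul_const (w j)
    simpa using this
  have h := integral_Ioi_of_hasDerivAt_of_tendsto' (a := 0) (fun z _ => hderiv z)
    (hT.integrableOn_cexp_mul θ _ i) hlim
  rw [h]
  simp [semigroup_zero, Matrix.one_apply, apply_ite Complex.ofReal]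

/-- The resolvent `(T + i θ I)⁻¹` exists on the imaginary axis. -/
lemma IsSubgenerator.exists_shifted_mulVec_eq {T : Matrix ι ι ℝ} (hT : IsSubgenerator T) (θ : ℝ)
    (v : ι → ℂ) : ∃ w, shifted T θ *ᵥ w = v := by
  have hinj : Function.Injective (shifted T θ).mulVec := by
    intro w w' h
    ext i
    have h1 := hT.integral_cexp_mul θ w i
    rw [show shifted T θ *ᵥ w = shifted T θ *ᵥ w' from h, hT.integral_cexp_mul θ w' i] at h1
    exact (neg_injective h1).symm
  exact Matrix.mulVec_surjective_iff_isUnit.2 (Matrix.mulVec_injective_iff_isUnit.1 hinj) v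

/-- The characteristic function of `PH_c(α, T)` at `θ` is `α w`, where `w` solves
`(T + i θ I) w = T e`. -/
lemma charFun_phLaw {α : ι → ℝ} (hα : IsProbVec α) {T : Matrix ι ι ℝ} (hT : IsSubgenerator T)
    (θ : ℝ) {w : ι → ℂ} (hw : ∀ i, (shifted T θ *ᵥ w) i = ∑ j, (T i j : ℂ)) :
    charFun (phLaw α T) θ = ∑ i, (α i : ℂ) * w i := by
  rw [charFun_apply_real, integral_phLaw hα hT]
  have hfun : ∀ z : ℝ, phDensity α T z • Complex.exp (θ * z * Complex.I)
      = ∑ i, -(α i : ℂ) * (Complex.exp (θ * z * Complex.I) *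
        ∑ j, (semigroup T z i j : ℂ) * (shifted T θ *ᵥ w) j) := by
    intro z
    rw [phDensity_eq_sum, Complex.real_smul]
    simp only [hw]
    simp only [Matrix.mulVec, dotProduct, Pi.one_apply, mul_one]
    push_cast
    rw [neg_mul, Finset.sum_mul, ← Finset.sum_neg_distrib]
    exact Finset.sum_congr rfl fun i _ => by ring
  simp only [hfun]
  rw [integral_finsetSum _ fun i _ => (hT.integrableOn_cexp_mul θ _ i).const_mul _]
  simp only [integral_const_mul, hT.integral_cexp_mul, neg_mul_neg]

/-! ### The compound matrix -/

/-- `I ⊗ T_c + T_d ⊗ (-T_c e α_c)` acts on a vector by `T_c` in the second coordinate, followed by a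
restart of that coordinate from `α_c` when the first coordinate moves. -/
lemma compound_mulVec {R m n : Type*} [CommRing R] [Fintype m] [DecidableEq m] [Fintype n]
    (Td : Matrix m m R) (αc : n → R) (Tc : Matrix n n R) (v : m × n → R) (a : m) (b : n) :
    (((1 : Matrix m m R) ⊗ₖ Tc + Td ⊗ₖ Matrix.vecMulVec (-(Tc *ᵥ 1)) αc) *ᵥ v) (a, b)
      = ∑ b', Tc b b' * v (a, b')
        - (∑ b', Tc b b') * ∑ a', Td a a' * ∑ b', αc b' * v (a', b') := by
  rw [Matrix.add_mulVec, Pi.add_apply, sub_eq_add_neg]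
  congr 1
  · simp [Matrix.mulVec, dotProduct, Fintype.sum_prod_type, Matrix.one_apply]
  · simp only [Matrix.mulVec, dotProduct, Fintype.sum_prod_type, Matrix.kroneckerMap_apply,
      Matrix.vecMulVec_apply, Pi.neg_apply, Pi.one_apply, mul_one]
    rw [← neg_mul, Finset.mul_sum]
    refine Finset.sum_congr rfl fun a' _ => ?_
    rw [Finset.mul_sum, Finset.mul_sum]
    exact Finset.sum_congr rfl fun b' _ => by ring

lemma isProbVec_compoundInit {m n : Type*} [Fintype m] [Fintype n] {αd : m → ℝ} {αc : n → ℝ}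
    (hd : IsProbVec αd) (hc : IsProbVec αc) :
    IsProbVec (compoundInit αd αc) where
  nonneg x := mul_nonneg (hd.nonneg _) (hc.nonneg _)
  sum_eq_one := by
    simp [compoundInit, Fintype.sum_prod_type, ← Finset.mul_sum, hc.sum_eq_one, hd.sum_eq_one]

/-- A vector `v` with `T_Z v = 0` has the form `v (a, b) = c a` with `c = T_d c`, as `T_c` is
invertible; hence `c = 0`, as `I - T_d` is invertible. -/
lemma isUnit_compoundSubgenerator {Td : Matrix ι ι ℝ} (hd : IsUnit (1 - Td)) {αc : κ → ℝ}
    (hαc : ∑ b, αc b = 1) {Tc : Matrix κ κ ℝ} (hc : IsUnit Tc) :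
    IsUnit (compoundSubgenerator Td αc Tc) := by
  rw [← Matrix.mulVec_injective_iff_isUnit, ← Matrix.coe_mulVecLin, ← LinearMap.ker_eq_bot,
    LinearMap.ker_eq_bot']
  intro v hv
  rw [Matrix.mulVecLin_apply] at hv
  set c : ι → ℝ := fun a => ∑ a', Td a a' * ∑ b', αc b' * v (a', b') with hcdef
  have hvc : ∀ a b, v (a, b) = c a := by
    intro a
    have h0 : (fun b => v (a, b) - c a) = 0 := by
      refine eq_zero_of_mulVec_eq_zero hc ?_
      ext b
      have h1 := congrFun hv (a, b)
      rw [compoundSubgenerator, compound_mulVec, Pi.zero_apply, Finset.sum_mul,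
        ← Finset.sum_sub_distrib] at h1
      simp only [← mul_sub] at h1
      exact h1
    exact fun b => sub_eq_zero.1 (congrFun h0 b)
  have hc0 : c = 0 := by
    refine eq_zero_of_mulVec_eq_zero hd ?_
    rw [Matrix.sub_mulVec, Matrix.one_mulVec, sub_eq_zero]
    ext a
    have hmean : ∀ a', ∑ b', αc b' * v (a', b') = c a' := fun a' => by
      simp only [hvc, ← Finset.sum_mul, hαc, one_mul]
    exact Finset.sum_congr rfl fun a' _ => by rw [hmean]
  ext ⟨a, b⟩
  simp [hvc, hc0]

lemma isSubgenerator_compoundSubgenerator {Td : Matrix ι ι ℝ} (hd : IsSubtransition Td)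
    {αc : κ → ℝ} (hαc : IsProbVec αc) {Tc : Matrix κ κ ℝ} (hc : IsSubgenerator Tc) :
    IsSubgenerator (compoundSubgenerator Td αc Tc) where
  offDiag_nonneg := by
    rintro ⟨a, b⟩ ⟨a', b'⟩ hne
    have h2 : 0 ≤ Td a a' * (-(Tc *ᵥ 1) b * αc b') :=
      mul_nonneg (hd.nonneg _ _)
        (mul_nonneg (neg_nonneg.2 (hc.mulVec_one_nonpos b)) (hαc.nonneg _))
    have h1 : 0 ≤ (1 : Matrix ι ι ℝ) a a' * Tc b b' := by
      by_cases ha : a = a'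
      · subst ha
        simpa using hc.offDiag_nonneg b b' (by rintro rfl; exact hne rfl)
      · simp [ha]
    exact add_nonneg h1 h2
  row_sum_le := by
    rintro ⟨a, b⟩
    have h := compound_mulVec Td αc Tc 1 a b
    simp only [Pi.one_apply, mul_one, hαc.sum_eq_one] at h
    have h2 : ∑ j, compoundSubgenerator Td αc Tc (a, b) j
        = (compoundSubgenerator Td αc Tc *ᵥ 1) (a, b) := by simp [Matrix.mulVec, dotProduct]
    rw [h2, compoundSubgenerator, h]
    nlinarith [hc.row_sum_le b, hd.row_sum_le a]
  isUnit := isUnit_compoundSubgenerator hd.isUnit hαc.sum_eq_one hc.isUnit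

end PhaseType

namespace PhaseType

open Filter Topology Set

variable {ι κ : Type*} [Fintype ι] [DecidableEq ι] [Fintype κ] [DecidableEq κ]

/-! ### Powers of a subtransition matrix -/

lemma IsSubtransition.mulVec_one_le {T : Matrix ι ι ℝ} (hT : IsSubtransition T) (i : ι) :
    (T *ᵥ 1) i ≤ 1 := by
  simpa [Matrix.mulVec, dotProduct] using hT.row_sum_le i

lemma IsSubtransition.pow_mulVec_one_succ_le {T : Matrix ι ι ℝ} (hT : IsSubtransition T) (m : ℕ)
    (i : ι) : ((T ^ (m + 1)) *ᵥ 1) i ≤ ((T ^ m) *ᵥ 1) i := by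
  rw [pow_succ, ← Matrix.mulVec_mulVec]
  exact mulVec_mono (pow_apply_nonneg hT.nonneg m) hT.mulVec_one_le i

lemma IsSubtransition.pow_mulVec_one_nonneg {T : Matrix ι ι ℝ} (hT : IsSubtransition T) (m : ℕ)
    (i : ι) : 0 ≤ ((T ^ m) *ᵥ 1) i :=
  mulVec_nonneg (pow_apply_nonneg hT.nonneg m) (fun _ => zero_le_one) i

lemma IsSubtransition.pow_mulVec_one_le {T : Matrix ι ι ℝ} (hT : IsSubtransition T) (m : ℕ)
    (i : ι) : ((T ^ m) *ᵥ 1) i ≤ 1 := by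
  simpa using antitone_nat_of_succ_le (f := fun m => ((T ^ m) *ᵥ 1) i)
    (fun m => hT.pow_mulVec_one_succ_le m i) (Nat.zero_le m)

/-- The survival probabilities `T ^ m e` decrease to a vector `v = T v`, which vanishes because
`I - T` is invertible. -/
lemma IsSubtransition.tendsto_pow_mulVec_one {T : Matrix ι ι ℝ} (hT : IsSubtransition T) (i : ι) :
    Tendsto (fun m => ((T ^ m) *ᵥ 1) i) atTop (𝓝 0) := by
  have hlim : ∀ i, ∃ l, Tendsto (fun m => ((T ^ m) *ᵥ 1) i) atTop (𝓝 l) := fun i =>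
    ⟨_, tendsto_atTop_ciInf (antitone_nat_of_succ_le fun m => hT.pow_mulVec_one_succ_le m i)
      ⟨0, by rintro _ ⟨m, rfl⟩; exact hT.pow_mulVec_one_nonneg m i⟩⟩
  choose v hv using hlim
  have hfix : (1 - T) *ᵥ v = 0 := by
    rw [Matrix.sub_mulVec, Matrix.one_mulVec, sub_eq_zero]
    ext i
    have h1 : Tendsto (fun m => ((T ^ (m + 1)) *ᵥ 1) i) atTop (𝓝 (v i)) :=
      (hv i).comp (tendsto_add_atTop_nat 1)
    have h2 : Tendsto (fun m => ((T ^ (m + 1)) *ᵥ 1) i) atTop (𝓝 ((T *ᵥ v) i)) := by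
      simp only [pow_succ', ← Matrix.mulVec_mulVec]
      exact tendsto_finsetSum _ fun j _ => (hv j).const_mul _
    exact tendsto_nhds_unique h1 h2
  simpa [eq_zero_of_mulVec_eq_zero hT.isUnit hfix] using hv i

/-- For `|φ| ≤ 1`, the generating function `u = ∑ φ ^ m T ^ m (e - T e)` of the absorption time
converges, and `u = (e - T e) + φ T u`. -/
lemma IsSubtransition.exists_generating_vector {T : Matrix ι ι ℝ} (hT : IsSubtransition T) {φ : ℂ}
    (hφ : ‖φ‖ ≤ 1) : ∃ u : ι → ℂ,
      (∀ i, HasSum (fun m : ℕ => φ ^ m *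
        ((((T ^ m) *ᵥ 1) i - ((T ^ (m + 1)) *ᵥ 1) i : ℝ) : ℂ)) (u i)) ∧
      ∀ i, u i = (1 - ∑ j, (T i j : ℂ)) + φ * ∑ j, (T i j : ℂ) * u j := by
  set s : ℕ → ι → ℝ := fun m i => ((T ^ m) *ᵥ 1) i - ((T ^ (m + 1)) *ᵥ 1) i with hs
  have hs0 : ∀ m i, 0 ≤ s m i := fun m i => sub_nonneg.2 (hT.pow_mulVec_one_succ_le m i)
  have hsum : ∀ i, Summable fun m : ℕ => φ ^ m * (s m i : ℂ) := by
    intro i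
    have h1 : Summable fun m => s m i := by
      refine summable_of_sum_range_le (c := 1) (fun m => hs0 m i) fun N => ?_
      rw [Finset.sum_range_sub' (fun m => ((T ^ m) *ᵥ 1) i)]
      have := hT.pow_mulVec_one_nonneg N i
      simp only [pow_zero, Matrix.one_mulVec, Pi.one_apply]
      linarith
    refine Summable.of_norm_bounded h1 fun m => ?_
    rw [norm_mul, norm_pow, Complex.norm_real, Real.norm_of_nonneg (hs0 m i)]
    exact mul_le_of_le_one_left (hs0 m i) (pow_le_one₀ (norm_nonneg _) hφ)
  refine ⟨fun i => ∑' m : ℕ, φ ^ m * (s m i : ℂ), fun i => (hsum i).hasSum, fun i => ?_⟩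
  have hstep : ∀ m, s (m + 1) i = ∑ j, T i j * s m j := by
    intro m
    have h : ∀ k, ((T ^ (k + 1)) *ᵥ 1) i = ∑ j, T i j * ((T ^ k) *ᵥ 1) j := fun k => by
      rw [pow_succ', ← Matrix.mulVec_mulVec]
      rfl
    simp only [hs, mul_sub, Finset.sum_sub_distrib, h]
  have hshift : HasSum (fun m : ℕ => φ ^ (m + 1) * (s (m + 1) i : ℂ))
      (φ * ∑ j, (T i j : ℂ) * ∑' m : ℕ, φ ^ m * (s m j : ℂ)) := by
    have h := (hasSum_sum fun j (_ : j ∈ Finset.univ) =>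
      ((hsum j).hasSum.mul_left (T i j : ℂ))).mul_left φ
    refine h.congr_fun fun m => ?_
    rw [hstep]
    push_cast
    rw [pow_succ', mul_assoc, Finset.mul_sum]
    congr 1
    exact Finset.sum_congr rfl fun j _ => by ring
  beta_reduce
  rw [(hsum i).tsum_eq_zero_add, hshift.tsum_eq]
  congr 1
  simp only [hs, zero_add, pow_zero, pow_one, Matrix.one_mulVec]
  simp [Matrix.mulVec, dotProduct]

variable {Ω : Type*} [MeasurableSpace Ω] {μ : Measure Ω}

section Law

variable {M : Ω → ℕ} {α : ι → ℝ} {T : Matrix ι ι ℝ}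

lemma IsPHd.measureReal_le (h : IsPHd M μ α T) (m : ℕ) :
    μ.real {ω | M ω ≤ m} = 1 - α ⬝ᵥ ((T ^ m) *ᵥ 1) := by
  rw [measureReal_def, h.measure_le m, absorbingTransition_pow_inr h.probVec,
    ENNReal.toReal_ofReal]
  rw [sub_nonneg, ← h.probVec.sum_eq_one]
  exact Finset.sum_le_sum fun i _ =>
    mul_le_of_le_one_right (h.probVec.nonneg i) (h.subtransition.pow_mulVec_one_le m i)

lemma IsPHd.measureReal_eq_zero (h : IsPHd M μ α T) : μ.real {ω | M ω = 0} = 0 := by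
  have := h.measureReal_le 0
  simpa [dotProduct_one, h.probVec.sum_eq_one] using this

lemma nullMeasurableSet_eq_nat (hM : AEMeasurable M μ) (m : ℕ) :
    NullMeasurableSet {ω | M ω = m} μ :=
  hM.nullMeasurableSet_preimage (measurableSet_singleton m)

lemma IsPHd.measureReal_eq_succ [IsProbabilityMeasure μ] (h : IsPHd M μ α T) (m : ℕ) :
    μ.real {ω | M ω = m + 1}
      = ∑ i, α i * (((T ^ m) *ᵥ 1) i - ((T ^ (m + 1)) *ᵥ 1) i) := by
  have hset : {ω | M ω ≤ m + 1} = {ω | M ω ≤ m} ∪ {ω | M ω = m + 1} := by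
    ext ω
    simp only [mem_ofPred_eq, mem_union]
    omega
  have hdisj : Disjoint {ω | M ω ≤ m} {ω | M ω = m + 1} := by
    rw [Set.disjoint_left]
    intro ω h1 h2
    simp only [mem_ofPred_eq] at h1 h2
    omega
  have h1 := measureReal_union₀ (nullMeasurableSet_eq_nat h.aemeasurable (m + 1))
    hdisj.aedisjoint (μ := μ)
  rw [← hset, h.measureReal_le, h.measureReal_le] at h1
  simp only [dotProduct] at h1
  simp only [mul_sub, Finset.sum_sub_distrib]
  linarith

end Law

/-! ### The random sum -/

lemma aemeasurable_randomSum {M : Ω → ℕ} {Y : ℕ → Ω → ℝ} (hM : AEMeasurable M μ)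
    (hY : ∀ m, AEMeasurable (Y m) μ) : AEMeasurable (randomSum M Y) μ := by
  have hf : Measurable fun p : ℕ × (ℕ → ℝ) => ∑ m ∈ Finset.range p.1, p.2 m :=
    measurable_from_prod_countable_right fun m => by
      exact Finset.measurable_fun_sum (Finset.range m) fun i _ =>
        (measurable_pi_apply i : Measurable fun y : ℕ → ℝ => y i)
  exact hf.comp_aemeasurable (hM.prodMk (aemeasurable_pi_lambda _ hY))

/-- Conditioning on the number of summands. -/
lemma hasSum_charFun_randomSum [IsProbabilityMeasure μ] {M : Ω → ℕ} {Y : ℕ → Ω → ℝ}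
    {ν : Measure ℝ} (hM : AEMeasurable M μ) (hY : ∀ m, AEMeasurable (Y m) μ)
    (hYindep : iIndepFun Y μ)
    (hYlaw : ∀ m, μ.map (Y m) = ν) (hMY : IndepFun M (fun ω m => Y m ω) μ) (θ : ℝ) :
    HasSum (fun m : ℕ => (μ.real {ω | M ω = m} : ℂ) * charFun ν θ ^ m)
      (charFun (μ.map (randomSum M Y)) θ) := by
  have hZ := aemeasurable_randomSum hM hY
  have hexp : Measurable fun x : ℝ => Complex.exp (θ * x * Complex.I) := by fun_prop
  have hcf : ∀ X : Ω → ℝ, AEMeasurable X μ →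
      charFun (μ.map X) θ = ∫ ω, Complex.exp (θ * X ω * Complex.I) ∂μ := fun X hX => by
    rw [charFun_apply_real, integral_map hX hexp.aestronglyMeasurable]
  have hint : Integrable (fun ω => Complex.exp (θ * randomSum M Y ω * Complex.I)) μ := by
    refine Integrable.of_bound (hexp.comp_aemeasurable hZ).aestronglyMeasurable 1 ?_
    exact Eventually.of_forall fun ω => (norm_cexp_mul_I θ _).le
  have hsum := hasSum_integral_iUnion_ae (μ := μ) (s := fun m : ℕ => {ω | M ω = m})
    (f := fun ω => Complex.exp (θ * randomSum M Y ω * Complex.I))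
    (fun m => nullMeasurableSet_eq_nat hM m)
    (fun m m' hne => Disjoint.aedisjoint <| Set.disjoint_left.2 fun ω h1 h2 =>
      hne (h1.symm.trans h2))
    hint.integrableOn
  have huniv : (⋃ m : ℕ, {ω | M ω = m}) = univ := by ext ω; simp
  rw [huniv, Measure.restrict_univ, ← hcf _ hZ] at hsum
  refine hsum.congr_fun fun m => ?_
  have hSm : AEMeasurable (fun ω => ∑ i ∈ Finset.range m, Y i ω) μ :=
    Finset.aemeasurable_fun_sum _ fun i _ => hY i
  have hpow : charFun ν θ ^ m
      = ∫ ω, Complex.exp (θ * (∑ i ∈ Finset.range m, Y i ω : ℝ) * Complex.I) ∂μ := by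
    rw [← hcf _ hSm, iIndepFun.charFun_map_fun_finsetSum_eq_prod (fun i _ => hY i)
      (hYindep.restrict _)]
    simp [hYlaw]
  have hind : IndepFun (fun ω => ({m} : Set ℕ).indicator (fun _ => (1 : ℂ)) (M ω))
      (fun ω => Complex.exp (θ * (∑ i ∈ Finset.range m, Y i ω : ℝ) * Complex.I)) μ :=
    hMY.comp (φ := ({m} : Set ℕ).indicator fun _ => (1 : ℂ))
      (ψ := fun y : ℕ → ℝ => Complex.exp (θ * (∑ i ∈ Finset.range m, y i : ℝ) * Complex.I))
      (measurable_of_countable _)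
      (hexp.comp (Finset.measurable_fun_sum _ fun i _ => measurable_pi_apply i))
  have hmul := hind.integral_fun_mul_eq_mul_integral
    ((measurable_of_countable
      (({m} : Set ℕ).indicator fun _ => (1 : ℂ))).comp_aemeasurable hM).aestronglyMeasurable
    (hexp.comp_aemeasurable hSm).aestronglyMeasurable
  have hind2 : (fun ω => ({m} : Set ℕ).indicator (fun _ => (1 : ℂ)) (M ω))
      = {ω | M ω = m}.indicator fun _ => (1 : ℂ) := rfl
  have hint1 : ∫ ω, ({m} : Set ℕ).indicator (fun _ => (1 : ℂ)) (M ω) ∂μ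
      = (μ.real {ω | M ω = m} : ℂ) := by
    rw [hind2, integral_indicator₀ (nullMeasurableSet_eq_nat hM m)]
    simp
  rw [hint1] at hmul
  rw [hpow, ← hmul, ← integral_indicator₀ (nullMeasurableSet_eq_nat hM m)]
  refine integral_congr_ae (Eventually.of_forall fun ω => ?_)
  by_cases hω : M ω = m <;> simp [hω, randomSum]

/-- The vector `w = u ⊗ y`, where `y` solves `(T_c + i θ I) y = T_c e` and `u` is the generating
function of `M` at `φ = α_c y`, solves `(T_Z + i θ I) w = T_Z e`. -/
lemma shifted_compound_mulVec {Td : Matrix ι ι ℝ} {αc : κ → ℝ} (hαc : ∑ b, αc b = 1)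
    {Tc : Matrix κ κ ℝ} {θ : ℝ} {y : κ → ℂ} (hy : ∀ b, (shifted Tc θ *ᵥ y) b = ∑ b', (Tc b b' : ℂ))
    {u : ι → ℂ}
    (hu : ∀ a, u a = (1 - ∑ a', (Td a a' : ℂ))
      + (∑ b, (αc b : ℂ) * y b) * ∑ a', (Td a a' : ℂ) * u a') (x : ι × κ) :
    (shifted (compoundSubgenerator Td αc Tc) θ *ᵥ fun x => u x.1 * y x.2) x
      = ∑ x', (compoundSubgenerator Td αc Tc x x' : ℂ) := by
  obtain ⟨a, b⟩ := x
  have hmap : ∀ x x', (compoundSubgenerator Td αc Tc x x' : ℂ)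
      = ((1 : Matrix ι ι ℂ) ⊗ₖ Tc.map (↑) + Td.map (↑) ⊗ₖ
        Matrix.vecMulVec (-(Tc.map (↑) *ᵥ 1)) (fun b => (αc b : ℂ)) : Matrix _ _ ℂ) x x' := by
    rintro ⟨a, b⟩ ⟨a', b'⟩
    simp [compoundSubgenerator, Matrix.kroneckerMap_apply, Matrix.vecMulVec_apply, Matrix.mulVec,
      dotProduct, Matrix.one_apply, apply_ite Complex.ofReal]
  have hvec := fun v : ι × κ → ℂ =>
    compound_mulVec (Td.map (↑)) (fun b => (αc b : ℂ)) (Tc.map (↑)) v a b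
  have hαc' : ∑ b, (αc b : ℂ) = 1 := by exact_mod_cast congrArg Complex.ofReal hαc
  have h1 := hvec fun x => u x.1 * y x.2
  have h2 := hvec 1
  have hyb := hy b
  rw [shifted_mulVec] at hyb ⊢
  simp only [Matrix.mulVec, dotProduct, ← hmap, Matrix.map_apply, Pi.one_apply, mul_one,
    hαc'] at h1 h2
  rw [h1, h2]
  simp only [mul_left_comm _ (u _), ← Finset.mul_sum]
  have hcomm : ∑ a', (Td a a' : ℂ) * (u a' * ∑ b', (αc b' : ℂ) * y b')
      = (∑ b', (αc b' : ℂ) * y b') * ∑ a', (Td a a' : ℂ) * u a' := by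
    rw [Finset.mul_sum]
    exact Finset.sum_congr rfl fun a' _ => by ring
  have hua := hu a
  simp only [mul_left_comm (Td a _ : ℂ) (u _)] at hcomm ⊢
  rw [hcomm]
  linear_combination u a * hyb + (∑ b', (Tc b b' : ℂ)) * hua

/-- A phase-type number of independent phase-type summands has a phase-type sum. -/
theorem IsPHd.isPHc_randomSum [IsProbabilityMeasure μ] {M : Ω → ℕ} {Y : ℕ → Ω → ℝ} {αd : ι → ℝ}
    {Td : Matrix ι ι ℝ} {αc : κ → ℝ} {Tc : Matrix κ κ ℝ} (hM : IsPHd M μ αd Td)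
    (hYindep : iIndepFun Y μ) (hYlaw : ∀ m, IsPHc (Y m) μ αc Tc)
    (hMY : IndepFun M (fun ω m => Y m ω) μ) :
    IsPHc (randomSum M Y) μ (compoundInit αd αc) (compoundSubgenerator Td αc Tc) := by
  have hαd := hM.probVec
  have hTd := hM.subtransition
  have hαc := (hYlaw 0).probVec
  have hTc := (hYlaw 0).subgenerator
  have hY : ∀ m, AEMeasurable (Y m) μ := fun m => (hYlaw m).aemeasurable
  have hZ := aemeasurable_randomSum hM.aemeasurable hY
  have hα := isProbVec_compoundInit hαd hαc
  have hT := isSubgenerator_compoundSubgenerator hTd hαc hTc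
  refine isPHc_of_map_eq_phLaw hZ hα hT ?_
  have := isProbabilityMeasure_phLaw hα hT
  have := isProbabilityMeasure_phLaw hαc hTc
  have := Measure.isProbabilityMeasure_map hZ
  refine Measure.ext_of_charFun (funext fun θ => ?_)
  obtain ⟨y, hy⟩ := hTc.exists_shifted_mulVec_eq θ fun b => ∑ b', (Tc b b' : ℂ)
  have hφ := charFun_phLaw hαc hTc θ (congrFun hy)
  obtain ⟨u, hu, hfix⟩ := hTd.exists_generating_vector
    (norm_charFun_le_one (μ := phLaw αc Tc) θ)
  rw [charFun_phLaw hα hT θ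
    (shifted_compound_mulVec hαc.sum_eq_one (congrFun hy) (by simpa only [hφ] using hfix))]
  have hsum := hasSum_charFun_randomSum hM.aemeasurable hY hYindep
    (fun m => (hYlaw m).map_eq_phLaw) hMY θ
  rw [← hasSum_nat_add_iff' 1] at hsum
  simp only [Finset.sum_range_one, hM.measureReal_eq_zero, Complex.ofReal_zero, zero_mul,
    sub_zero] at hsum
  have hsum2 := (hasSum_sum fun i (_ : i ∈ Finset.univ) =>
    (hu i).mul_left (αd i : ℂ)).mul_left (charFun (phLaw αc Tc) θ)
  have heq := hsum.unique (hsum2.congr_fun fun m => ?_)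
  · rw [heq, hφ, Fintype.sum_prod_type, Finset.mul_sum]
    refine Finset.sum_congr rfl fun a _ => ?_
    rw [Finset.sum_mul]
    refine Finset.sum_congr rfl fun b _ => ?_
    simp only [compoundInit]
    push_cast
    ring
  · rw [hM.measureReal_eq_succ, Finset.mul_sum]
    push_cast
    rw [Finset.sum_mul]
    exact Finset.sum_congr rfl fun i _ => by ring

end PhaseType

namespace BalancedSystem

open Filter Topology PhaseType

variable {n k : ℕ} {BC : Finset (Fin n) → Prop} {r : ℝ}

/-! ### The one-shock transition probabilities -/

lemma shockTransition_nonneg (hr0 : 0 ≤ r) (hr1 : r ≤ 1) (a b : Finset (Fin n)) :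
    0 ≤ shockTransition r a b := by
  refine Finset.prod_nonneg fun i _ => ?_
  split_ifs <;> linarith

lemma shockTransition_eq_zero {a b : Finset (Fin n)} (h : ¬b ⊆ a) : shockTransition r a b = 0 := by
  obtain ⟨i, hib, hia⟩ := Finset.not_subset.1 h
  exact Finset.prod_eq_zero (Finset.mem_univ i) (by simp [hib, hia])

lemma shockTransition_self (a : Finset (Fin n)) : shockTransition r a a = r ^ a.card := by
  have h : ∀ i, (if i ∈ a then (if i ∈ a then r else 1 - r) else (if i ∈ a then 0 else 1))
      = if i ∈ a then r else 1 := fun i => by split_ifs <;> rfl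
  simp [shockTransition, h]

lemma sum_shockTransition (a : Finset (Fin n)) : ∑ b, shockTransition r a b = 1 := by
  have h := Finset.prod_add (fun i => if i ∈ a then r else 0)
    (fun i => if i ∈ a then 1 - r else 1) Finset.univ
  have h1 : ∀ i, (if i ∈ a then r else 0) + (if i ∈ a then 1 - r else 1) = 1 := fun i => by
    split_ifs <;> ring
  simp only [h1, Finset.prod_const_one, Finset.powerset_univ] at h
  rw [h]
  refine Finset.sum_congr rfl fun b _ => ?_
  have h2 : ∀ i, (if i ∈ a then (if i ∈ b then r else 1 - r) else (if i ∈ b then 0 else 1))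
      = if i ∈ b then (if i ∈ a then r else 0) else (if i ∈ a then 1 - r else 1) := fun i => by
    split_ifs <;> rfl
  simp only [shockTransition, h2]
  rw [Finset.prod_ite, Finset.filter_univ_mem, Finset.filter_notMem_eq_sdiff]

lemma Nonfailed.card_pos (hk : 1 ≤ k) {x : Finset (Fin n)} (h : Nonfailed k BC x) : 0 < x.card := by
  obtain ⟨A, hA, hAx⟩ := h
  exact (hk.trans hA.prop.1).trans (Finset.card_le_card hAx)

/-- A shock can only remove units, so `P_BC` is triangular for inclusion; its diagonal entries
`r ^ |a|` differ from `1` because a nonfailed state has a nonfailed unit. -/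
lemma isUnit_one_sub_PBC (hk : 1 ≤ k) (hr0 : 0 ≤ r) (hr1 : r < 1) :
    IsUnit (1 - PBC k BC r) := by
  rw [← Matrix.mulVec_injective_iff_isUnit, ← Matrix.coe_mulVecLin, ← LinearMap.ker_eq_bot,
    LinearMap.ker_eq_bot']
  intro v hv
  rw [Matrix.mulVecLin_apply, Matrix.sub_mulVec, Matrix.one_mulVec, sub_eq_zero] at hv
  have h : ∀ (c : ℕ) (a : NonfailedState k BC), a.1.card = c → v a = 0 := by
    intro c
    induction c using Nat.strong_induction_on with
    | _ c ih =>
      intro a hac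
      have h1 : v a = shockTransition r a.1 a.1 * v a := by
        conv_lhs => rw [hv]
        refine Finset.sum_eq_single a (fun b _ hba => ?_) (by simp)
        by_cases hsub : b.1 ⊆ a.1
        · have hlt := Finset.card_lt_card (hsub.ssubset_of_ne fun h => hba (Subtype.ext h))
          rw [ih b.1.card (hac ▸ hlt) b rfl, mul_zero]
        · simp [PBC, shockTransition_eq_zero hsub]
      have h2 : r ^ a.1.card < 1 := pow_lt_one₀ hr0 hr1 (a.2.card_pos hk).ne'
      rw [shockTransition_self] at h1
      have h3 : (1 - r ^ a.1.card) * v a = 0 := by linarith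
      exact (mul_eq_zero.1 h3).resolve_left (by linarith)
  exact funext fun a => h _ a rfl

lemma isSubtransition_PBC (hk : 1 ≤ k) (hr0 : 0 ≤ r) (hr1 : r < 1) :
    IsSubtransition (PBC k BC r) where
  nonneg a b := shockTransition_nonneg hr0 hr1.le _ _
  row_sum_le a := by
    rw [← sum_shockTransition (r := r) a.1]
    calc ∑ b, PBC k BC r a b
        = ∑ b ∈ Finset.univ.map (Function.Embedding.subtype (Nonfailed k BC)),
            shockTransition r a.1 b := by
          rw [Finset.sum_map]
          rfl
      _ ≤ ∑ b, shockTransition r a.1 b :=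
          Finset.sum_le_sum_of_subset_of_nonneg (Finset.subset_univ _)
            fun b _ _ => shockTransition_nonneg hr0 hr1.le _ _
  isUnit := isUnit_one_sub_PBC hk hr0 hr1

lemma perfectInit_dotProduct (h : Nonfailed k BC Finset.univ) (f : NonfailedState k BC → ℝ) :
    perfectInit k BC ⬝ᵥ f = f ⟨Finset.univ, h⟩ := by
  refine (Finset.sum_eq_single (⟨Finset.univ, h⟩ : NonfailedState k BC) (fun b _ hb => ?_)
    (by simp)).trans (by simp [perfectInit])
  have hne : b.1 ≠ Finset.univ := fun h' => hb (Subtype.ext h')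
  simp [perfectInit, hne]

lemma isProbVec_perfectInit (h : Nonfailed k BC Finset.univ) : IsProbVec (perfectInit k BC) where
  nonneg a := by
    unfold perfectInit
    split_ifs <;> norm_num
  sum_eq_one := by
    have := perfectInit_dotProduct h 1
    rwa [dotProduct_one] at this

/-! ### The shock number to failure -/

/-- The second alternative covers the junk value `sInf ∅ = 0` on the event that the system never
fails. -/
lemma shockNumberToFailure_le_iff {Ω : Type*} {X : ℕ → Ω → Finset (Fin n)} (ω : Ω) (m : ℕ) :
    shockNumberToFailure k BC X ω ≤ m ↔ (¬∀ ν, 1 ≤ ν → ν ≤ m → Nonfailed k BC (X ν ω)) ∨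
      ∀ j ν, 1 ≤ ν → ν ≤ j → Nonfailed k BC (X ν ω) := by
  constructor
  · intro h
    by_contra hcon
    push Not at hcon
    obtain ⟨h1, j, ν, h2, -, h3⟩ := hcon
    have hmem := Nat.sInf_mem (s := {ν | 1 ≤ ν ∧ ¬Nonfailed k BC (X ν ω)}) ⟨ν, h2, h3⟩
    exact hmem.2 (h1 _ hmem.1 h)
  · rintro (h | h)
    · push Not at h
      obtain ⟨ν, h1, h2, h3⟩ := h
      exact (Nat.sInf_le (⟨h1, h3⟩ : ν ∈ {ν | 1 ≤ ν ∧ ¬Nonfailed k BC (X ν ω)})).trans h2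
    · have hempty : {ν | 1 ≤ ν ∧ ¬Nonfailed k BC (X ν ω)} = ∅ :=
        Set.eq_empty_of_forall_notMem fun ν hν => hν.2 (h ν ν hν.1 le_rfl)
      rw [shockNumberToFailure, hempty, Nat.sInf_empty]
      exact Nat.zero_le m

variable {Ω : Type*} [MeasurableSpace Ω] {μ : Measure Ω} {X : ℕ → Ω → Finset (Fin n)}

lemma IsStateProcess.measurable_prop (hX : IsStateProcess r X μ) (ν : ℕ)
    (p : Finset (Fin n) → Prop) : Measurable fun ω => p (X ν ω) := by
  refine measurableSet_setOfPred.1 ?_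
  have h : {ω | p (X ν ω)} = ⋃ x : {x // p x}, {ω | X ν ω = x.1} := by
    ext ω
    simp
  rw [h]
  exact MeasurableSet.iUnion fun x => hX.measurableSet ν x.1

lemma IsStateProcess.measureReal_path (hX : IsStateProcess r X μ) (hr0 : 0 ≤ r) (hr1 : r ≤ 1)
    (m : ℕ) (x : ℕ → Finset (Fin n)) :
    μ.real {ω | ∀ ν ≤ m, X ν ω = x ν} = (if x 0 = Finset.univ then 1 else 0) *
      ∏ ν ∈ Finset.range m, shockTransition r (x ν) (x (ν + 1)) := by
  rw [measureReal_def, hX.measure_path, ENNReal.toReal_ofReal]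
  refine mul_nonneg (by split_ifs <;> norm_num) ?_
  exact Finset.prod_nonneg fun ν _ => shockTransition_nonneg hr0 hr1 _ _

/-- After a path which ends in the nonfailed state `a`, the system survives the next `l` shocks with
probability `(P_BC ^ l e) a`. In the induction over `l` the path is prolonged by the state after
the next shock. -/
lemma IsStateProcess.measureReal_path_nonfailed [IsProbabilityMeasure μ]
    (hX : IsStateProcess r X μ) (hr0 : 0 ≤ r) (hr1 : r ≤ 1) (l : ℕ) :
    ∀ (m : ℕ) (x : ℕ → Finset (Fin n)) (hx : Nonfailed k BC (x m)),
      μ.real {ω | (∀ ν ≤ m, X ν ω = x ν) ∧ ∀ ν, m < ν → ν ≤ m + l → Nonfailed k BC (X ν ω)}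
        = μ.real {ω | ∀ ν ≤ m, X ν ω = x ν} * ((PBC k BC r ^ l) *ᵥ 1) ⟨x m, hx⟩ := by
  induction l with
  | zero =>
    intro m x hx
    have h : ∀ ω, ∀ ν, m < ν → ν ≤ m + 0 → Nonfailed k BC (X ν ω) := fun ω ν h1 h2 => by omega
    simp only [pow_zero, Matrix.one_mulVec, Pi.one_apply, mul_one]
    congr 1
    ext ω
    exact and_iff_left (h ω)
  | succ l ih =>
    intro m x hx
    set x' : Finset (Fin n) → ℕ → Finset (Fin n) := fun b => Function.update x (m + 1) b with hx'
    have hlast : ∀ b, x' b (m + 1) = b := fun b => Function.update_self ..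
    have hinit : ∀ b, ∀ ν ≤ m, x' b ν = x ν := fun b ν hν =>
      Function.update_of_ne (by omega) _ _
    set S : NonfailedState k BC → Set Ω := fun b => {ω | (∀ ν ≤ m + 1, X ν ω = x' b.1 ν) ∧
      ∀ ν, m + 1 < ν → ν ≤ m + 1 + l → Nonfailed k BC (X ν ω)} with hS
    have hunion : {ω | (∀ ν ≤ m, X ν ω = x ν) ∧
        ∀ ν, m < ν → ν ≤ m + (l + 1) → Nonfailed k BC (X ν ω)} = ⋃ b, S b := by
      ext ω
      simp only [hS, Set.mem_iUnion, Set.mem_ofPred_eq]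
      constructor
      · rintro ⟨h1, h2⟩
        refine ⟨⟨X (m + 1) ω, h2 (m + 1) (by omega) (by omega)⟩, fun ν hν => ?_, fun ν h3 h4 =>
          h2 ν (by omega) (by omega)⟩
        rcases Nat.lt_or_ge m ν with h | h
        · obtain rfl : ν = m + 1 := by omega
          rw [hlast]
        · rw [hinit _ ν h, h1 ν h]
      · rintro ⟨b, h1, h2⟩
        refine ⟨fun ν hν => by rw [h1 ν (by omega), hinit _ ν hν], fun ν h3 h4 => ?_⟩
        rcases Nat.lt_or_ge (m + 1) ν with h | h
        · exact h2 ν h (by omega)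
        · obtain rfl : ν = m + 1 := by omega
          rw [h1 _ le_rfl, hlast]
          exact b.2
    have hdisj : Pairwise (Function.onFun Disjoint S) := by
      intro b b' hne
      refine Set.disjoint_left.2 fun ω h1 h2 => hne (Subtype.ext ?_)
      rw [← hlast b.1, ← hlast b'.1, ← h1.1 _ le_rfl, ← h2.1 _ le_rfl]
    have hmeas : ∀ b, MeasurableSet (S b) := fun b =>
      measurableSet_setOfPred.2 (Measurable.and
        (Measurable.forall fun ν => Measurable.forall fun _ => hX.measurable_prop ν (· = x' b.1 ν))
        (Measurable.forall fun ν => Measurable.forall fun _ => Measurable.forall fun _ =>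
          hX.measurable_prop ν (Nonfailed k BC)))
    have hstep : ∀ b : NonfailedState k BC, μ.real (S b)
        = μ.real {ω | ∀ ν ≤ m, X ν ω = x ν} *
          (PBC k BC r ⟨x m, hx⟩ b * ((PBC k BC r ^ l) *ᵥ 1) b) := by
      intro b
      have hb : Nonfailed k BC (x' b.1 (m + 1)) := by
        rw [hlast]
        exact b.2
      have hpath : μ.real {ω | ∀ ν ≤ m + 1, X ν ω = x' b.1 ν}
          = μ.real {ω | ∀ ν ≤ m, X ν ω = x ν} * shockTransition r (x m) b.1 := by
        rw [hX.measureReal_path hr0 hr1, hX.measureReal_path hr0 hr1, Finset.prod_range_succ,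
          hlast, hinit _ m le_rfl, hinit _ 0 (Nat.zero_le m), ← mul_assoc]
        congr 2
        refine Finset.prod_congr rfl fun ν hν => ?_
        rw [Finset.mem_range] at hν
        rw [hinit _ ν hν.le, hinit _ (ν + 1) hν]
      have hbeq : (⟨x' b.1 (m + 1), hb⟩ : NonfailedState k BC) = b := Subtype.ext (hlast b.1)
      rw [hS, ih (m + 1) (x' b.1) hb, hpath, hbeq, mul_assoc]
      rfl
    rw [hunion, measureReal_iUnion_fintype hdisj hmeas, pow_succ', ← Matrix.mulVec_mulVec]
    simp only [hstep, ← Finset.mul_sum]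
    rfl

lemma measurable_survives (hX : IsStateProcess r X μ) (m : ℕ) :
    Measurable fun ω => ∀ ν, 1 ≤ ν → ν ≤ m → Nonfailed k BC (X ν ω) :=
  Measurable.forall fun ν => Measurable.forall fun _ => Measurable.forall fun _ =>
    hX.measurable_prop ν (Nonfailed k BC)

lemma IsStateProcess.measureReal_survives [IsProbabilityMeasure μ] (hX : IsStateProcess r X μ)
    (hr0 : 0 ≤ r) (hr1 : r ≤ 1) (h : Nonfailed k BC Finset.univ) (m : ℕ) :
    μ.real {ω | ∀ ν, 1 ≤ ν → ν ≤ m → Nonfailed k BC (X ν ω)}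
      = perfectInit k BC ⬝ᵥ ((PBC k BC r ^ m) *ᵥ 1) := by
  have hstart : μ.real {ω | ∀ ν ≤ 0, X ν ω = (Finset.univ : Finset (Fin n))} = 1 := by
    rw [hX.measureReal_path hr0 hr1 0 fun _ => Finset.univ]
    simp
  have hae : ∀ᵐ ω ∂μ, ∀ ν ≤ 0, X ν ω = (Finset.univ : Finset (Fin n)) := by
    have hms : MeasurableSet {ω | ∀ ν ≤ 0, X ν ω = (Finset.univ : Finset (Fin n))} :=
      measurableSet_setOfPred.2 (Measurable.forall fun ν => Measurable.forall fun _ =>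
        hX.measurable_prop ν (· = Finset.univ))
    rw [ae_iff_prob_eq_one (measurableSet_setOfPred.1 hms)]
    rw [measureReal_def] at hstart
    exact (ENNReal.toReal_eq_one_iff _).1 hstart
  have hpath := hX.measureReal_path_nonfailed (k := k) (BC := BC) hr0 hr1 m 0
    (fun _ => Finset.univ) h
  rw [hstart, one_mul] at hpath
  rw [perfectInit_dotProduct h, ← hpath]
  refine measureReal_congr ?_
  filter_upwards [hae] with ω hω
  refine propext ⟨fun h1 => ⟨hω, fun ν h2 h3 => h1 ν h2 (by omega)⟩, fun h1 ν h2 h3 =>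
    h1.2 ν h2 (by omega)⟩

lemma IsStateProcess.measurable_shockNumberToFailure (hX : IsStateProcess r X μ) :
    Measurable (shockNumberToFailure k BC X) := by
  refine measurable_of_Iic fun m => ?_
  have h : shockNumberToFailure k BC X ⁻¹' Set.Iic m
      = {ω | (¬∀ ν, 1 ≤ ν → ν ≤ m → Nonfailed k BC (X ν ω)) ∨
        ∀ j ν, 1 ≤ ν → ν ≤ j → Nonfailed k BC (X ν ω)} :=
    Set.ext fun ω => shockNumberToFailure_le_iff ω m
  rw [h]
  exact measurableSet_setOfPred.2
    ((measurable_survives hX m).not.or (Measurable.forall fun j => measurable_survives hX j))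

lemma IsStateProcess.ae_exists_failed [IsProbabilityMeasure μ] (hX : IsStateProcess r X μ)
    (hk : 1 ≤ k) (hr0 : 0 ≤ r) (hr1 : r < 1) (h : Nonfailed k BC Finset.univ) :
    ∀ᵐ ω ∂μ, ¬∀ j ν, 1 ≤ ν → ν ≤ j → Nonfailed k BC (X ν ω) := by
  have hlim := (isSubtransition_PBC (BC := BC) hk hr0 hr1).tendsto_pow_mulVec_one
    ⟨Finset.univ, h⟩
  have hle : μ.real {ω | ∀ j ν, 1 ≤ ν → ν ≤ j → Nonfailed k BC (X ν ω)} ≤ 0 := by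
    refine ge_of_tendsto' hlim fun m => ?_
    have hm := hX.measureReal_survives hr0 hr1.le h m
    rw [perfectInit_dotProduct h] at hm
    rw [← hm]
    exact measureReal_mono fun ω hω => hω m
  have h0 := hle.antisymm measureReal_nonneg
  rw [measureReal_eq_zero_iff] at h0
  rw [ae_iff]
  simpa only [not_not] using h0

/-- The shock number to failure is the absorption time of the chain of nonfailed states. -/
theorem IsStateProcess.isPHd_shockNumberToFailure [IsProbabilityMeasure μ]
    (hX : IsStateProcess r X μ) (hk : 1 ≤ k) (hr0 : 0 ≤ r) (hr1 : r < 1)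
    (h : Nonfailed k BC Finset.univ) :
    IsPHd (shockNumberToFailure k BC X) μ (perfectInit k BC) (PBC k BC r) where
  probVec := isProbVec_perfectInit h
  subtransition := isSubtransition_PBC hk hr0 hr1
  aemeasurable := hX.measurable_shockNumberToFailure.aemeasurable
  measure_le m := by
    rw [absorbingTransition_pow_inr (isProbVec_perfectInit h),
      ← hX.measureReal_survives hr0 hr1.le h m,
      ← probReal_compl_eq_one_sub (measurableSet_setOfPred.2 (measurable_survives hX m)),
      ofReal_measureReal]
    refine measure_congr ?_
    filter_upwards [hX.ae_exists_failed hk hr0 hr1 h] with ω hω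
    exact propext ((shockNumberToFailure_le_iff ω m).trans (or_iff_left hω))

end BalancedSystem

/-! ### Time to failure -/

theorem proposition2 {Ω : Type*} [MeasurableSpace Ω] (μ : Measure Ω) [IsProbabilityMeasure μ]
    {κ : Type*} [Fintype κ] [DecidableEq κ] (αc : κ → ℝ) (Tc : Matrix κ κ ℝ)
    (Y : ℕ → Ω → ℝ) (hYindep : iIndepFun Y μ)
    (hYlaw : ∀ m, PhaseType.IsPHc (Y m) μ αc Tc) :
    -- any phase-type shock number `M`
    (∀ {ι : Type*} [Fintype ι] [DecidableEq ι] (αd : ι → ℝ) (Td : Matrix ι ι ℝ) (M : Ω → ℕ),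
      PhaseType.IsPHd M μ αd Td →
      IndepFun M (fun ω m => Y m ω) μ →
      PhaseType.IsPHc (PhaseType.randomSum M Y) μ
          (PhaseType.compoundInit αd αc) (PhaseType.compoundSubgenerator Td αc Tc) ∧
        PhaseType.HasPHDensity (PhaseType.randomSum M Y) μ
          (PhaseType.compoundInit αd αc) (PhaseType.compoundSubgenerator Td αc Tc) ∧
        PhaseType.HasPHMoments (PhaseType.randomSum M Y) μ
          (PhaseType.compoundInit αd αc) (PhaseType.compoundSubgenerator Td αc Tc)) ∧
    -- the shock number to failure of a circular `k`-out-of-`n`: G balanced system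
    (∀ (n k : ℕ) (BC : Finset (Fin n) → Prop) (r : ℝ) (X : ℕ → Ω → Finset (Fin n)),
      1 ≤ k → BalancedSystem.Nonfailed k BC Finset.univ → 0 ≤ r → r < 1 →
      BalancedSystem.IsStateProcess r X μ →
      PhaseType.IsPHd (BalancedSystem.shockNumberToFailure k BC X) μ
          (BalancedSystem.perfectInit k BC) (BalancedSystem.PBC k BC r) ∧
        (IndepFun (BalancedSystem.shockNumberToFailure k BC X) (fun ω m => Y m ω) μ →
        PhaseType.IsPHc
          (PhaseType.randomSum (BalancedSystem.shockNumberToFailure k BC X) Y) μ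
          (PhaseType.compoundInit (BalancedSystem.perfectInit k BC) αc)
          (PhaseType.compoundSubgenerator (BalancedSystem.PBC k BC r) αc Tc) ∧
        PhaseType.HasPHDensity
          (PhaseType.randomSum (BalancedSystem.shockNumberToFailure k BC X) Y) μ
          (PhaseType.compoundInit (BalancedSystem.perfectInit k BC) αc)
          (PhaseType.compoundSubgenerator (BalancedSystem.PBC k BC r) αc Tc) ∧
        PhaseType.HasPHMoments
          (PhaseType.randomSum (BalancedSystem.shockNumberToFailure k BC X) Y) μ
          (PhaseType.compoundInit (BalancedSystem.perfectInit k BC) αc)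
          (PhaseType.compoundSubgenerator (BalancedSystem.PBC k BC r) αc Tc))) := by
  refine ⟨fun αd Td M hM hMY => ?_, fun n k BC r X hk h hr0 hr1 hX => ?_⟩
  · have hZ := hM.isPHc_randomSum hYindep hYlaw hMY
    exact ⟨hZ, hZ.hasPHDensity, hZ.hasPHMoments⟩
  · have hM := hX.isPHd_shockNumberToFailure hk hr0 hr1 h
    refine ⟨hM, fun hMY => ?_⟩
    have hZ := hM.isPHc_randomSum hYindep hYlaw hMY
    exact ⟨hZ, hZ.hasPHDensity, hZ.hasPHMoments⟩
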